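/- Let $\triangle_H=\{(z,w)\in\mathbb C^2:|z|<|w|<1\}$ be the Hartogs triangle and let $H^2(\triangle_H)$ be the Hilbert space of all holomorphic functions $f$ on $\triangle_H$ with $$\|f\|^2=\sup_{0<s,t<1}\frac1{4\pi^2}\int_0^{2\pi}\!\!\int_0^{2\pi}\bigl|f(st e^{i\theta},te^{i\gamma})\bigr|^2\,st^2\,d\theta\,d\gamma<\infty .$$ Let $M_z,M_w$ be the operators of multiplication by the coordinates $z,w$ on $H^2(\triangle_H)$, and let $H^2_+(\triangle_H)$ be the subspace of all $f\in H^2(\triangle_H)$ that have an expansion $f(z,w)=\sum_{i,j\ge 0}a_{ij}z^iw^j$ on $\triangle_H$. A submodule of $H^2(\triangle_H)$ is a closed subspace $\mathcal S$ invariant under $M_z$ and $M_w$; put $S_z=M_z|_{\mathcal S}$ and $S_w=M_w|_{\mathcal S}$, and call $\mathcal S$ doubly commuting if $S_z^*S_w-S_wS_z^*=0$ on $\mathcal S$. A function $q$ on $\triangle_H$ is called unimodular if it has a boundary function on $\mathbb T^2$ (the limit in $L^2(\mathbb T^2)$ of $(\zeta_1,\zeta_2)\mapsto q(st\zeta_1,t\zeta_2)$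 as $s,t\to1^-$) and this boundary function has modulus $1$ almost everywhere on $\mathbb T^2$. **Theorem.** Let $\mathcal S\ne\{0\}$ be a submodule of $H^2(\triangle_H)$. Then $\mathcal S$ is doubly commuting if and only if $\mathcal S=q\,H^2_+(\triangle_H)=\{qg: g\in H^2_+(\triangle_H)\}$ for some unimodular function $q$ on $\triangle_H$. -/

import Mathlib

/-!
# The Hardy space of the Hartogs triangle

`HardySpace` is the Hilbert space of holomorphic functions on the Hartogs triangle with bounded
integral means. Most of what follows is the proof that the limits of the integral means define
a complete inner product on it: the coefficients of the Laurent expansion embed it isometrically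
in `ℓ²`. Submodules, double commutativity, the subspace of power series, and boundary functions
are defined at the end.
-/

noncomputable section

open MeasureTheory Filter Topology Set
open scoped ComplexConjugate ENNReal

namespace Hartogs

/-! ### The triangle, the torus and the integral means -/

/-- The Hartogs triangle `{(z, w) : |z| < |w| < 1}`. -/
def triangle : Set (ℂ × ℂ) := {p | ‖p.1‖ < ‖p.2‖ ∧ ‖p.2‖ < 1}

/-- The torus `𝕋²`, which is the distinguished boundary of the triangle; `x` stands for the point
`(exp (2πi x₀), exp (2πi x₁))`. -/
abbrev Torus : Type := UnitAddTorus (Fin 2)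

/-- The normalized Lebesgue measure `dθ dγ / 4π²` on `𝕋²`. -/
abbrev torusMeasure : Measure Torus := Measure.pi fun _ => AddCircle.haarAddCircle

/-- Extension by zero of a function on the triangle to `ℂ²`. -/
def extZero (f : triangle → ℂ) : ℂ × ℂ → ℂ := Function.extend Subtype.val f 0

/-- Holomorphic functions on the triangle. -/
def IsHolomorphic (f : triangle → ℂ) : Prop := DifferentiableOn ℂ (extZero f) triangle

/-- The dilate `(e^{iθ}, e^{iγ}) ↦ f (s t e^{iθ}, t e^{iγ})`, for `0 < s, t < 1`. -/
def slice (f : triangle → ℂ) (s t : ℝ) (x : Torus) : ℂ :=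
  extZero f ((s : ℂ) * t * (x 0).toCircle, (t : ℂ) * (x 1).toCircle)

/-- `(1 / 4π²) ∫∫ |f (s t e^{iθ}, t e^{iγ})|² s t² dθ dγ`. -/
def mean (f : triangle → ℂ) (s t : ℝ) : ℝ :=
  ∫ x, ‖slice f s t x‖ ^ 2 * (s * t ^ 2) ∂torusMeasure

lemma extZero_of_mem (f : triangle → ℂ) {p : ℂ × ℂ} (hp : p ∈ triangle) :
    extZero f p = f ⟨p, hp⟩ :=
  Subtype.val_injective.extend_apply f 0 ⟨p, hp⟩

lemma extZero_add (f g : triangle → ℂ) : extZero (f + g) = extZero f + extZero g := by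
  ext p
  by_cases hp : p ∈ triangle
  · simp [extZero_of_mem _ hp]
  · have : ¬ ∃ a : triangle, a.1 = p := by rintro ⟨a, rfl⟩; exact hp a.2
    simp [extZero, Function.extend_apply' _ _ _ this]

lemma extZero_smul (c : ℂ) (f : triangle → ℂ) : extZero (c • f) = c • extZero f := by
  ext p
  by_cases hp : p ∈ triangle
  · simp [extZero_of_mem _ hp]
  · have : ¬ ∃ a : triangle, a.1 = p := by rintro ⟨a, rfl⟩; exact hp a.2
    simp [extZero, Function.extend_apply' _ _ _ this]

lemma extZero_zero : extZero 0 = 0 := by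
  simpa using extZero_smul 0 0

lemma slice_add (f g : triangle → ℂ) (s t : ℝ) : slice (f + g) s t = slice f s t + slice g s t := by
  ext x; simp [slice, extZero_add]

lemma slice_smul (c : ℂ) (f : triangle → ℂ) (s t : ℝ) : slice (c • f) s t = c • slice f s t := by
  ext x; simp [slice, extZero_smul]

lemma mem_triangle {s t : ℝ} (hs : s ∈ Ioo (0 : ℝ) 1) (ht : t ∈ Ioo (0 : ℝ) 1) (a b : Circle) :
    ((s : ℂ) * t * a, (t : ℂ) * b) ∈ triangle := by
  simp only [triangle, mem_ofPred_eq, norm_mul, Complex.norm_real, Circle.norm_coe, mul_one,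
    Real.norm_eq_abs, abs_of_pos hs.1, abs_of_pos ht.1]
  exact ⟨by nlinarith [hs.2, ht.1], ht.2⟩

lemma slice_apply (f : triangle → ℂ) {s t : ℝ} (hs : s ∈ Ioo (0 : ℝ) 1) (ht : t ∈ Ioo (0 : ℝ) 1)
    (x : Torus) : slice f s t x = f ⟨_, mem_triangle hs ht (x 0).toCircle (x 1).toCircle⟩ :=
  extZero_of_mem f _

lemma continuous_slice {f : triangle → ℂ} (hf : IsHolomorphic f) {s t : ℝ}
    (hs : s ∈ Ioo (0 : ℝ) 1) (ht : t ∈ Ioo (0 : ℝ) 1) : Continuous (slice f s t) := by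
  have h : Continuous fun x : Torus =>
      (((s : ℂ) * t * (x 0).toCircle, (t : ℂ) * (x 1).toCircle) : ℂ × ℂ) := by
    have h0 := AddCircle.continuous_toCircle (T := 1)
    fun_prop
  exact hf.continuousOn.comp_continuous h fun x => mem_triangle hs ht _ _

lemma integrable_of_continuous {E : Type*} [NormedAddCommGroup E] {F : Torus → E} (hF : Continuous F) :
    Integrable F torusMeasure :=
  hF.integrable_of_hasCompactSupport (HasCompactSupport.of_compactSpace F)

lemma mean_add_le {f g : triangle → ℂ} (hf : IsHolomorphic f) (hg : IsHolomorphic g) {s t : ℝ}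
    (hs : s ∈ Ioo (0 : ℝ) 1) (ht : t ∈ Ioo (0 : ℝ) 1) :
    mean (f + g) s t ≤ 2 * mean f s t + 2 * mean g s t := by
  have cf := continuous_slice hf hs ht
  have cg := continuous_slice hg hs ht
  simp only [mean, slice_add]
  rw [← integral_const_mul, ← integral_const_mul, ← integral_add]
  · refine integral_mono ?_ ?_ fun x => ?_
    · exact integrable_of_continuous (by fun_prop)
    · exact integrable_of_continuous (by fun_prop)
    · have h1 := norm_add_le (slice f s t x) (slice g s t x)
      have h2 : 0 ≤ s * t ^ 2 := by have := hs.1; positivity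
      have h3 : ‖slice f s t x + slice g s t x‖ ^ 2 ≤
          2 * ‖slice f s t x‖ ^ 2 + 2 * ‖slice g s t x‖ ^ 2 := by
        nlinarith [norm_nonneg (slice f s t x + slice g s t x),
          sq_nonneg (‖slice f s t x‖ - ‖slice g s t x‖)]
      simp only [Pi.add_apply]
      nlinarith
  · exact integrable_of_continuous (by fun_prop)
  · exact integrable_of_continuous (by fun_prop)

lemma mean_smul (c : ℂ) (f : triangle → ℂ) (s t : ℝ) : mean (c • f) s t = ‖c‖ ^ 2 * mean f s t := by
  simp only [mean, slice_smul]
  rw [← integral_const_mul]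
  congr 1; ext x
  simp [mul_pow]; ring

/-- The holomorphic functions on the triangle whose integral means are bounded for `0 < s, t < 1`. -/
def hardySubspace : Submodule ℂ (triangle → ℂ) where
  carrier := {f | IsHolomorphic f ∧
    ∃ C : ℝ, ∀ s ∈ Ioo (0 : ℝ) 1, ∀ t ∈ Ioo (0 : ℝ) 1, mean f s t ≤ C}
  add_mem' := by
    rintro f g ⟨hf, C, hC⟩ ⟨hg, D, hD⟩
    refine ⟨?_, 2 * C + 2 * D, fun s hs t ht => ?_⟩
    · rw [IsHolomorphic, extZero_add]; exact hf.add hg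
    · linarith [mean_add_le hf hg hs ht, hC s hs t ht, hD s hs t ht]
  zero_mem' := by
    refine ⟨?_, 0, fun s hs t ht => ?_⟩
    · rw [IsHolomorphic, extZero_zero]; exact differentiableOn_const 0
    · simp [mean, slice, extZero_zero]
  smul_mem' := by
    rintro c f ⟨hf, C, hC⟩
    refine ⟨?_, ‖c‖ ^ 2 * C, fun s hs t ht => ?_⟩
    · rw [IsHolomorphic, extZero_smul]; exact hf.const_smul c
    · rw [mean_smul]; exact mul_le_mul_of_nonneg_left (hC s hs t ht) (by positivity)

/-- The Hardy space `H²` of the triangle. A type synonym, since the topology is that of the Hardy norm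
and not the one of pointwise convergence. -/
def HardySpace : Type := hardySubspace

instance : AddCommGroup HardySpace := inferInstanceAs (AddCommGroup hardySubspace)
instance : Module ℂ HardySpace := inferInstanceAs (Module ℂ hardySubspace)
instance : FunLike HardySpace triangle ℂ where
  coe f := f.1
  coe_injective _ _ h := Subtype.ext h

lemma exists_toCircle {v : ℂ} (hv : v ≠ 0) : ∃ x : UnitAddCircle, v = ‖v‖ * (x.toCircle : ℂ) := by
  have hn : (‖v‖ : ℂ) ≠ 0 := by simpa using hv
  have hu : v / ‖v‖ ∈ Submonoid.unitSphere ℂ := by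
    simp [Submonoid.unitSphere, hv]
  obtain ⟨x, hx⟩ := (AddCircle.homeomorphCircle (one_ne_zero (α := ℝ))).surjective ⟨_, hu⟩
  refine ⟨x, ?_⟩
  rw [AddCircle.homeomorphCircle_apply] at hx
  rw [hx]
  field_simp

lemma HardySpace.coe_mem (f : HardySpace) : (f : triangle → ℂ) ∈ hardySubspace := f.2

/-! ### Laurent coefficients -/

lemma annulus_coeff {h : ℂ → ℂ} {R : ℝ} (hh : ∀ z, 0 < ‖z‖ → ‖z‖ < R → DifferentiableAt ℂ h z)
    (n : ℤ) {r₁ r₂ : ℝ} (h1 : 0 < r₁) (h12 : r₁ ≤ r₂) (h2 : r₂ < R) :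
    (r₁ : ℂ) ^ (-n) * ∫ x, fourier (-n) x * h (r₁ * (AddCircle.toCircle x : ℂ))
        ∂(AddCircle.haarAddCircle (T := 1)) =
    (r₂ : ℂ) ^ (-n) * ∫ x, fourier (-n) x * h (r₂ * (AddCircle.toCircle x : ℂ))
        ∂(AddCircle.haarAddCircle (T := 1)) := by
  have key : ∀ r : ℝ, 0 < r →
      (∮ z in C(0, r), (z - 0)⁻¹ • (z ^ (-n) * h z)) = 2 * Real.pi * Complex.I *
      ((r : ℂ) ^ (-n) * ∫ x, fourier (-n) x * h (r * (AddCircle.toCircle x : ℂ))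
        ∂(AddCircle.haarAddCircle (T := 1))) := by
    intro r hr
    have hv : (AddCircle.haarAddCircle (T := 1)) = (volume : Measure (AddCircle (1 : ℝ))) := by
      simp [AddCircle.volume_eq_smul_haarAddCircle]
    rw [hv, ← AddCircle.intervalIntegral_preimage 1 0, ← intervalIntegral.integral_const_mul,
      ← intervalIntegral.integral_const_mul, circleIntegral]
    have e1 := intervalIntegral.smul_integral_comp_mul_left (a := 0) (b := 1)
      (fun θ : ℝ => deriv (circleMap 0 r) θ • (circleMap 0 r θ - 0)⁻¹ •
        (circleMap 0 r θ ^ (-n) * h (circleMap 0 r θ))) (2 * Real.pi)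
    simp only [mul_zero, mul_one] at e1
    rw [← e1, ← intervalIntegral.integral_smul]
    simp only [zero_add]
    congr 1; ext θ
    have c1 : circleMap 0 r (2 * Real.pi * θ) = r * ((AddCircle.toCircle (θ : AddCircle (1:ℝ))) : ℂ) := by
      rw [AddCircle.toCircle_apply_mk]; simp [circleMap]
    have c2 : (fourier (-n) (θ : AddCircle (1:ℝ)) : ℂ) =
        ((AddCircle.toCircle (θ : AddCircle (1:ℝ))) : ℂ) ^ (-n) := by
      rw [fourier_apply, AddCircle.toCircle_zsmul]; simp
    have c3 : (r : ℂ) * ((AddCircle.toCircle (θ : AddCircle (1:ℝ))) : ℂ) ≠ 0 := by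
      simp [hr.ne']
    rw [deriv_circleMap, c1, c2]
    simp only [sub_zero, smul_eq_mul, Complex.real_smul]
    have hr' : (r : ℂ) ≠ 0 := by simp [hr.ne']
    rw [mul_zpow]
    push_cast
    field_simp
  have hd : ∀ z, r₁ ≤ ‖z‖ → ‖z‖ ≤ r₂ → DifferentiableAt ℂ (fun z => z ^ (-n) * h z) z := by
    intro z hz1 hz2
    have hz : z ≠ 0 := by rintro rfl; simp at hz1; linarith
    exact (differentiableAt_zpow.2 (Or.inl hz)).mul (hh z (by simpa using hz) (by linarith))
  have := Complex.circleIntegral_sub_center_inv_smul_eq_of_differentiable_on_annulus_off_countable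
    (c := 0) h1 h12 (f := fun z => z ^ (-n) * h z) countable_empty
    (fun z hz => (hd z (by simpa using hz.2) (by simpa using hz.1)).continuousAt.continuousWithinAt)
    (fun z hz => hd z (by simpa using le_of_lt (by simpa using hz.1.2))
      (le_of_lt (by simpa using hz.1.1)))
  rw [key r₁ h1, key r₂ (h1.trans_le h12)] at this
  exact (mul_left_cancel₀ (by simp [Real.pi_ne_zero]) this).symm

lemma fourierCoeff_eq (F : Torus → ℂ) (α : Fin 2 → ℤ) :
    UnitAddTorus.mFourierCoeff F α =
      ∫ x, fourier (-α 0) (x 0) * fourier (-α 1) (x 1) * F x ∂torusMeasure := by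
  change ∫ x, UnitAddTorus.mFourier (-α) x • F x ∂torusMeasure = _
  simp [UnitAddTorus.mFourier]

lemma integral_torus {F : Torus → ℂ} (hF : Continuous F) :
    ∫ x, F x ∂torusMeasure = ∫ b, ∫ a, F ![a, b]
      ∂(AddCircle.haarAddCircle (T := 1)) ∂(AddCircle.haarAddCircle (T := 1)) := by
  have h := (measurePreserving_finTwoArrow (AddCircle.haarAddCircle (T := 1))).symm
  rw [← h.integral_comp (MeasurableEquiv.measurableEmbedding _), integral_prod_symm]
  · rfl
  · have : Continuous fun p : UnitAddCircle × UnitAddCircle => F ![p.1, p.2] :=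
      hF.comp (by fun_prop)
    exact this.integrable_of_hasCompactSupport (HasCompactSupport.of_compactSpace _)

lemma integral_torus_twist {F : Torus → ℂ} (hF : Continuous F) :
    ∫ x, F x ∂torusMeasure = ∫ a, ∫ b, F ![a + b, b]
      ∂(AddCircle.haarAddCircle (T := 1)) ∂(AddCircle.haarAddCircle (T := 1)) := by
  have h1 : Continuous fun p : UnitAddCircle × UnitAddCircle => F ![p.1 + p.2, p.2] :=
    hF.comp (by fun_prop)
  rw [integral_torus hF, integral_integral_swap (f := fun a b => F ![a + b, b])
    (h1.integrable_of_hasCompactSupport (HasCompactSupport.of_compactSpace _))]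
  congr 1; ext b
  exact (integral_add_right_eq_self (fun a => F ![a, b]) b).symm

lemma continuous_coeff_integrand {f : triangle → ℂ} (hf : IsHolomorphic f) {s t : ℝ}
    (hs : s ∈ Ioo (0 : ℝ) 1) (ht : t ∈ Ioo (0 : ℝ) 1) (m n : ℤ) :
    Continuous fun x : Torus => fourier m (x 0) * fourier n (x 1) * slice f s t x := by
  have := continuous_slice hf hs ht
  fun_prop

lemma isOpen_triangle : IsOpen triangle :=
  (isOpen_lt (continuous_norm.comp continuous_fst) (continuous_norm.comp continuous_snd)).inter
    (isOpen_lt (continuous_norm.comp continuous_snd) continuous_const)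

lemma coeff_indep_left {f : triangle → ℂ} (hf : IsHolomorphic f) (α : Fin 2 → ℤ) {s₁ s₂ t : ℝ}
    (hs₁ : s₁ ∈ Ioo (0 : ℝ) 1) (hs₂ : s₂ ∈ Ioo (0 : ℝ) 1) (h12 : s₁ ≤ s₂)
    (ht : t ∈ Ioo (0 : ℝ) 1) :
    (s₁ : ℂ) ^ (-α 0) * UnitAddTorus.mFourierCoeff (slice f s₁ t) α =
      (s₂ : ℂ) ^ (-α 0) * UnitAddTorus.mFourierCoeff (slice f s₂ t) α := by
  have ht0 : (t : ℂ) ≠ 0 := by simp [ht.1.ne']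
  rw [fourierCoeff_eq, fourierCoeff_eq, integral_torus (continuous_coeff_integrand hf hs₁ ht _ _),
    integral_torus (continuous_coeff_integrand hf hs₂ ht _ _), ← integral_const_mul,
    ← integral_const_mul]
  congr 1; ext b
  have hd : ∀ z : ℂ, 0 < ‖z‖ → ‖z‖ < 1 →
      DifferentiableAt ℂ (fun z => extZero f (z * t, t * b.toCircle)) z := by
    intro z _ hz
    have hm : (z * t, (t : ℂ) * b.toCircle) ∈ triangle := by
      simp only [triangle, mem_ofPred_eq, norm_mul, Complex.norm_real, Circle.norm_coe, mul_one,
        Real.norm_eq_abs, abs_of_pos ht.1]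
      exact ⟨by nlinarith [ht.1], ht.2⟩
    exact (hf.differentiableAt (isOpen_triangle.mem_nhds hm)).comp (f := fun z : ℂ =>
      (z * t, (t : ℂ) * b.toCircle)) z (by fun_prop)
  have := annulus_coeff hd (α 0) hs₁.1 h12 hs₂.2
  have e : ∀ s : ℝ, ∀ a : UnitAddCircle, fourier (-α 0) ((![a, b] : Torus) 0) *
      fourier (-α 1) ((![a, b] : Torus) 1) * slice f s t ![a, b] =
      fourier (-α 1) b * (fourier (-α 0) a * extZero f (s * a.toCircle * t, t * b.toCircle)) := by
    intro s a
    simp only [slice, Matrix.cons_val_zero, Matrix.cons_val_one]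
    rw [mul_right_comm (s : ℂ)]; ring
  simp only [e, integral_const_mul]
  rw [mul_left_comm, this, mul_left_comm]

lemma coeff_indep_right {f : triangle → ℂ} (hf : IsHolomorphic f) (α : Fin 2 → ℤ) {s t₁ t₂ : ℝ}
    (hs : s ∈ Ioo (0 : ℝ) 1) (ht₁ : t₁ ∈ Ioo (0 : ℝ) 1) (ht₂ : t₂ ∈ Ioo (0 : ℝ) 1)
    (h12 : t₁ ≤ t₂) :
    (t₁ : ℂ) ^ (-(α 0 + α 1)) * UnitAddTorus.mFourierCoeff (slice f s t₁) α =
      (t₂ : ℂ) ^ (-(α 0 + α 1)) * UnitAddTorus.mFourierCoeff (slice f s t₂) α := by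
  rw [fourierCoeff_eq, fourierCoeff_eq,
    integral_torus_twist (continuous_coeff_integrand hf hs ht₁ _ _),
    integral_torus_twist (continuous_coeff_integrand hf hs ht₂ _ _), ← integral_const_mul,
    ← integral_const_mul]
  congr 1; ext a
  have hd : ∀ w : ℂ, 0 < ‖w‖ → ‖w‖ < 1 →
      DifferentiableAt ℂ (fun w => extZero f (s * a.toCircle * w, w)) w := by
    intro w hw hw1
    have hm : ((s : ℂ) * a.toCircle * w, w) ∈ triangle := by
      simp only [triangle, mem_ofPred_eq, norm_mul, Complex.norm_real, Circle.norm_coe, mul_one,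
        Real.norm_eq_abs, abs_of_pos hs.1]
      exact ⟨by nlinarith [hs.2], hw1⟩
    exact (hf.differentiableAt (isOpen_triangle.mem_nhds hm)).comp (f := fun w : ℂ =>
      ((s : ℂ) * a.toCircle * w, w)) w (by fun_prop)
  have := annulus_coeff hd (α 0 + α 1) ht₁.1 h12 ht₂.2
  have e : ∀ t : ℝ, ∀ b : UnitAddCircle, fourier (-α 0) ((![a + b, b] : Torus) 0) *
      fourier (-α 1) ((![a + b, b] : Torus) 1) * slice f s t ![a + b, b] =
      fourier (-α 0) a * (fourier (-(α 0 + α 1)) b *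
        extZero f (s * a.toCircle * (t * b.toCircle), t * b.toCircle)) := by
    intro t b
    have e1 : (fourier (-α 0) (a + b) : ℂ) = fourier (-α 0) a * fourier (-α 0) b := by
      simp [fourier_apply, AddCircle.toCircle_add, smul_add]
    have e2 : (fourier (-(α 0 + α 1)) b : ℂ) = fourier (-α 0) b * fourier (-α 1) b := by
      rw [neg_add, fourier_add]
    have e3 : (s : ℂ) * a.toCircle * (t * b.toCircle) = s * t * (a + b).toCircle := by
      rw [AddCircle.toCircle_add]; push_cast; ring
    rw [e2, e3]
    simp only [slice, Matrix.cons_val_zero, Matrix.cons_val_one, e1]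
    ring
  simp only [e, integral_const_mul]
  rw [mul_left_comm, this, mul_left_comm]

/-- The coefficient of `z ^ α₀ * w ^ α₁` in the Laurent expansion of `f`. -/
def coeff (f : triangle → ℂ) (α : Fin 2 → ℤ) : ℂ :=
  ((2⁻¹ : ℝ) : ℂ) ^ (-α 0) * ((2⁻¹ : ℝ) : ℂ) ^ (-(α 0 + α 1)) *
    UnitAddTorus.mFourierCoeff (slice f 2⁻¹ 2⁻¹) α

lemma mFourierCoeff_slice {f : triangle → ℂ} (hf : IsHolomorphic f) (α : Fin 2 → ℤ) {s t : ℝ}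
    (hs : s ∈ Ioo (0 : ℝ) 1) (ht : t ∈ Ioo (0 : ℝ) 1) :
    UnitAddTorus.mFourierCoeff (slice f s t) α =
      coeff f α * (s : ℂ) ^ α 0 * (t : ℂ) ^ (α 0 + α 1) := by
  have h2 : (2⁻¹ : ℝ) ∈ Ioo (0 : ℝ) 1 := by constructor <;> norm_num
  have hl : ((2⁻¹ : ℝ) : ℂ) ^ (-α 0) * UnitAddTorus.mFourierCoeff (slice f 2⁻¹ 2⁻¹) α =
      (s : ℂ) ^ (-α 0) * UnitAddTorus.mFourierCoeff (slice f s 2⁻¹) α := by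
    rcases le_total 2⁻¹ s with h | h
    · exact coeff_indep_left hf α h2 hs h h2
    · exact (coeff_indep_left hf α hs h2 h h2).symm
  have hr : ((2⁻¹ : ℝ) : ℂ) ^ (-(α 0 + α 1)) * UnitAddTorus.mFourierCoeff (slice f s 2⁻¹) α =
      (t : ℂ) ^ (-(α 0 + α 1)) * UnitAddTorus.mFourierCoeff (slice f s t) α := by
    rcases le_total 2⁻¹ t with h | h
    · exact coeff_indep_right hf α hs h2 ht h
    · exact (coeff_indep_right hf α hs ht h2 h).symm
  have hs0 : (s : ℂ) ≠ 0 := by simp [hs.1.ne']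
  have ht0 : (t : ℂ) ≠ 0 := by simp [ht.1.ne']
  have e : coeff f α = (s : ℂ) ^ (-α 0) * ((t : ℂ) ^ (-(α 0 + α 1)) *
      UnitAddTorus.mFourierCoeff (slice f s t) α) := by
    rw [← hr, mul_left_comm, ← hl, coeff]; ring
  rw [e, zpow_neg, zpow_neg]
  have a1 := zpow_ne_zero (α 0) hs0
  have a2 := zpow_ne_zero (α 0 + α 1) ht0
  field_simp

lemma parseval {F G : Torus → ℂ} (hF : Continuous F) (hG : Continuous G) :
    HasSum (fun α => conj (UnitAddTorus.mFourierCoeff F α) * UnitAddTorus.mFourierCoeff G α)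
      (∫ x, conj (F x) * G x ∂torusMeasure) := by
  have h := UnitAddTorus.hasSum_prod_mFourierCoeff
    (ContinuousMap.toLp 2 torusMeasure ℂ ⟨F, hF⟩) (ContinuousMap.toLp 2 torusMeasure ℂ ⟨G, hG⟩)
  have e1 : ∀ (H : C(Torus, ℂ)) (α : Fin 2 → ℤ), UnitAddTorus.mFourierCoeff
      (ContinuousMap.toLp 2 torusMeasure ℂ H) α = UnitAddTorus.mFourierCoeff H α :=
    fun H α => UnitAddTorus.mFourierCoeff_toLp H α
  simp only [e1] at h
  have e2 : ∫ x, conj (F x) * G x ∂torusMeasure =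
      ∫ x, conj (ContinuousMap.toLp 2 torusMeasure ℂ ⟨F, hF⟩ x) *
        ContinuousMap.toLp 2 torusMeasure ℂ ⟨G, hG⟩ x ∂torusMeasure := by
    refine integral_congr_ae ?_
    filter_upwards [ContinuousMap.coeFn_toLp (p := 2) (𝕜 := ℂ) torusMeasure ⟨F, hF⟩,
      ContinuousMap.coeFn_toLp (p := 2) (𝕜 := ℂ) torusMeasure ⟨G, hG⟩] with x h1 h2
    rw [h1, h2]; rfl
  rw [e2]
  exact h

/-- `(1 / 4π²) ∫∫ conj (f (s t e^{iθ}, t e^{iγ})) g (s t e^{iθ}, t e^{iγ}) s t² dθ dγ`. -/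
def innerMean (f g : triangle → ℂ) (s t : ℝ) : ℂ :=
  ∫ x, conj (slice f s t x) * slice g s t x * (s * t ^ 2) ∂torusMeasure

def weight (α : Fin 2 → ℤ) (s t : ℝ) : ℝ := s ^ (2 * α 0 + 1) * t ^ (2 * (α 0 + α 1 + 1))

lemma weight_eq (α : Fin 2 → ℤ) {s t : ℝ} (hs : s ∈ Ioo (0 : ℝ) 1) (ht : t ∈ Ioo (0 : ℝ) 1) :
    weight α s t = (s ^ α 0) ^ 2 * (t ^ (α 0 + α 1)) ^ 2 * (s * t ^ 2) := by
  have hs0 := hs.1.ne'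
  have ht0 := ht.1.ne'
  rw [weight, zpow_add₀ hs0, mul_add, zpow_add₀ ht0, mul_comm 2, mul_comm 2, zpow_mul, zpow_mul]
  norm_cast
  ring

lemma hasSum_innerMean {f g : triangle → ℂ} (hf : IsHolomorphic f) (hg : IsHolomorphic g) {s t : ℝ}
    (hs : s ∈ Ioo (0 : ℝ) 1) (ht : t ∈ Ioo (0 : ℝ) 1) :
    HasSum (fun α => conj (coeff f α) * coeff g α * (weight α s t : ℂ)) (innerMean f g s t) := by
  have h := (parseval (continuous_slice hf hs ht) (continuous_slice hg hs ht)).mul_right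
    ((s : ℂ) * t ^ 2)
  rw [← integral_mul_const (L := ℂ)] at h
  refine HasSum.congr_fun h fun α => ?_
  rw [mFourierCoeff_slice hf α hs ht, mFourierCoeff_slice hg α hs ht, weight_eq α hs ht]
  simp only [map_mul, map_zpow₀, Complex.conj_ofReal]
  push_cast
  ring

lemma innerMean_self (f : triangle → ℂ) (s t : ℝ) : innerMean f f s t = mean f s t := by
  rw [innerMean, mean, ← integral_complex_ofReal]
  congr 1; ext x
  rw [Complex.conj_mul']; push_cast; ring

lemma hasSum_mean {f : triangle → ℂ} (hf : IsHolomorphic f) {s t : ℝ}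
    (hs : s ∈ Ioo (0 : ℝ) 1) (ht : t ∈ Ioo (0 : ℝ) 1) :
    HasSum (fun α => ‖coeff f α‖ ^ 2 * weight α s t) (mean f s t) := by
  have h := hasSum_innerMean hf hf hs ht
  rw [innerMean_self] at h
  have := Complex.hasSum_re h
  simp only [Complex.ofReal_re] at this
  refine HasSum.congr_fun this fun α => ?_
  rw [Complex.conj_mul']; norm_cast

lemma weight_nonneg (α : Fin 2 → ℤ) {s t : ℝ} (hs : s ∈ Ioo (0 : ℝ) 1) (ht : t ∈ Ioo (0 : ℝ) 1) :
    0 ≤ weight α s t := by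
  have := hs.1; have := ht.1; rw [weight]; positivity

/-- The exponents that occur in functions of the Hardy space. -/
def indexSet : Set (Fin 2 → ℤ) := {α | 0 ≤ α 0 ∧ 0 ≤ α 0 + α 1 + 1}

lemma weight_le_one {α : Fin 2 → ℤ} (hα : α ∈ indexSet) {s t : ℝ} (hs : s ∈ Ioo (0 : ℝ) 1)
    (ht : t ∈ Ioo (0 : ℝ) 1) : weight α s t ≤ 1 := by
  have h1 : s ^ (2 * α 0 + 1) ≤ 1 := zpow_le_one₀ hs.1 hs.2.le (by have := hα.1; lia)
  have h2 : t ^ (2 * (α 0 + α 1 + 1)) ≤ 1 := zpow_le_one₀ ht.1 ht.2.le (by have := hα.2; lia)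
  have := ht.1
  exact mul_le_one₀ h1 (by positivity) h2

/-- The filter `(s, t) → (1, 1)` with `s < 1` and `t < 1`. -/
def toOne : Filter (ℝ × ℝ) := 𝓝[<] 1 ×ˢ 𝓝[<] 1

lemma eventually_toOne : ∀ᶠ p in toOne, p.1 ∈ Ioo (0 : ℝ) 1 ∧ p.2 ∈ Ioo (0 : ℝ) 1 := by
  have h : ∀ᶠ s in 𝓝[<] (1 : ℝ), s ∈ Ioo (0 : ℝ) 1 := Ioo_mem_nhdsLT one_pos
  exact h.prod_mk h

instance : toOne.NeBot := by unfold toOne; infer_instance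

lemma tendsto_weight (α : Fin 2 → ℤ) :
    Tendsto (fun p : ℝ × ℝ => weight α p.1 p.2) toOne (𝓝 1) := by
  have h : Tendsto (fun p : ℝ × ℝ => weight α p.1 p.2) (𝓝 ((1 : ℝ), (1 : ℝ))) (𝓝 (weight α 1 1)) := by
    unfold weight
    refine Tendsto.mul ?_ ?_
    · exact (continuousAt_zpow₀ (1 : ℝ) _ (Or.inl one_ne_zero)).tendsto.comp
        (continuous_fst.tendsto ((1 : ℝ), (1 : ℝ)))
    · exact (continuousAt_zpow₀ (1 : ℝ) _ (Or.inl one_ne_zero)).tendsto.comp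
        (continuous_snd.tendsto ((1 : ℝ), (1 : ℝ)))
  have e : weight α 1 1 = 1 := by simp [weight]
  rw [e] at h
  refine h.mono_left ?_
  rw [nhds_prod_eq]
  exact Filter.prod_mono nhdsWithin_le_nhds nhdsWithin_le_nhds

lemma coeff_eq_zero {f : triangle → ℂ} (hf : f ∈ hardySubspace) {α : Fin 2 → ℤ}
    (hα : α ∉ indexSet) : coeff f α = 0 := by
  obtain ⟨hf, C, hC⟩ := hf
  by_contra h0
  have h2 : (2⁻¹ : ℝ) ∈ Ioo (0 : ℝ) 1 := by constructor <;> norm_num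
  have hb : ∀ s ∈ Ioo (0 : ℝ) 1, ∀ t ∈ Ioo (0 : ℝ) 1, weight α s t ≤ C / ‖coeff f α‖ ^ 2 := by
    intro s hs t ht
    rw [le_div_iff₀ (by positivity), mul_comm]
    exact (le_hasSum (hasSum_mean hf hs ht) α fun β _ => mul_nonneg (by positivity)
      (weight_nonneg β hs ht)).trans (hC s hs t ht)
  have hT : ∀ n : ℤ, n < 0 → Tendsto (fun s : ℝ => s ^ n) (𝓝[>] 0) atTop := by
    intro n hn
    obtain ⟨k, rfl⟩ : ∃ k : ℕ, n = -(k + 1 : ℕ) := ⟨(-n - 1).toNat, by lia⟩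
    simp only [zpow_neg, zpow_natCast]
    refine ((tendsto_pow_atTop (Nat.succ_ne_zero k)).comp
      (tendsto_inv_nhdsGT_zero (𝕜 := ℝ))).congr fun x => ?_
    simp
  have hI : ∀ᶠ s in 𝓝[>] (0 : ℝ), s ∈ Ioo (0 : ℝ) 1 := Ioo_mem_nhdsGT one_pos
  rcases lt_or_ge (α 0) 0 with h | h
  · have := (hT (2 * α 0 + 1) (by lia)).atTop_mul_const
      (show (0 : ℝ) < 2⁻¹ ^ (2 * (α 0 + α 1 + 1)) by positivity)
    obtain ⟨s, h1, h3⟩ := ((this.eventually_gt_atTop (C / ‖coeff f α‖ ^ 2)).and hI).exists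
    exact absurd (hb s h3 _ h2) (not_le.2 h1)
  · have h' : α 0 + α 1 + 1 < 0 := by
      by_contra h''; exact hα ⟨h, by lia⟩
    have := (hT (2 * (α 0 + α 1 + 1)) (by lia)).const_mul_atTop
      (show (0 : ℝ) < 2⁻¹ ^ (2 * α 0 + 1) by positivity)
    obtain ⟨t, h1, h3⟩ := ((this.eventually_gt_atTop (C / ‖coeff f α‖ ^ 2)).and hI).exists
    exact absurd (hb _ h2 t h3) (not_le.2 h1)

lemma summable_coeff {f : triangle → ℂ} (hf : f ∈ hardySubspace) :
    Summable fun α => ‖coeff f α‖ ^ 2 := by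
  obtain ⟨hf, C, hC⟩ := hf
  refine summable_of_sum_le (c := C) (fun _ => by positivity) fun u => ?_
  have h1 : Tendsto (fun p : ℝ × ℝ => ∑ α ∈ u, ‖coeff f α‖ ^ 2 * weight α p.1 p.2) toOne
      (𝓝 (∑ α ∈ u, ‖coeff f α‖ ^ 2 * 1)) :=
    tendsto_finsetSum _ fun α _ => (tendsto_weight α).const_mul _
  simp only [mul_one] at h1
  refine le_of_tendsto h1 (eventually_toOne.mono fun p hp => ?_)
  exact (sum_le_hasSum u (fun β _ => mul_nonneg (by positivity) (weight_nonneg β hp.1 hp.2))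
    (hasSum_mean hf hp.1 hp.2)).trans (hC _ hp.1 _ hp.2)

lemma memlp_coeff {f : triangle → ℂ} (hf : f ∈ hardySubspace) : Memℓp (coeff f) 2 :=
  memℓp_gen (by simpa using summable_coeff hf)

lemma coeff_add {f g : triangle → ℂ} (hf : IsHolomorphic f) (hg : IsHolomorphic g) :
    coeff (f + g) = coeff f + coeff g := by
  ext α
  have h2 : (2⁻¹ : ℝ) ∈ Ioo (0 : ℝ) 1 := by constructor <;> norm_num
  simp only [coeff, fourierCoeff_eq, slice_add, Pi.add_apply, mul_add]
  rw [integral_add (integrable_of_continuous (continuous_coeff_integrand hf h2 h2 _ _))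
    (integrable_of_continuous (continuous_coeff_integrand hg h2 h2 _ _)), mul_add]

lemma coeff_smul (c : ℂ) (f : triangle → ℂ) : coeff (c • f) = c • coeff f := by
  ext α
  simp only [coeff, fourierCoeff_eq, slice_smul, Pi.smul_apply, smul_eq_mul, mul_left_comm _ c,
    integral_const_mul]

/-- The sequence of Laurent coefficients, as an element of `ℓ²`. -/
def coeffMap : HardySpace →ₗ[ℂ] lp (fun _ : Fin 2 → ℤ => ℂ) 2 where
  toFun f := ⟨coeff f, memlp_coeff f.2⟩
  map_add' f g := Subtype.ext (coeff_add f.2.1 g.2.1)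
  map_smul' c f := Subtype.ext (coeff_smul c f)

lemma coeffMap_apply (f : HardySpace) (α : Fin 2 → ℤ) : coeffMap f α = coeff f α := rfl

lemma coeffMap_injective : Function.Injective coeffMap := by
  rw [← LinearMap.ker_eq_bot, LinearMap.ker_eq_bot']
  intro f hf
  have hc : ∀ α, coeff f α = 0 := fun α => by rw [← coeffMap_apply, hf]; rfl
  have hm : ∀ s ∈ Ioo (0 : ℝ) 1, ∀ t ∈ Ioo (0 : ℝ) 1, ∀ x, slice f s t x = 0 := by
    intro s hs t ht
    have h := hasSum_mean f.coe_mem.1 hs ht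
    simp only [hc, norm_zero, zero_pow two_ne_zero, zero_mul] at h
    have h0 := h.unique hasSum_zero
    have cs := continuous_slice f.coe_mem.1 hs ht
    have hst : 0 < s * t ^ 2 := by have := hs.1; have := ht.1; positivity
    rw [mean, integral_eq_zero_iff_of_nonneg (fun x => by positivity)
      (integrable_of_continuous (by fun_prop)), Continuous.ae_eq_iff_eq _ (by fun_prop)
      continuous_zero] at h0
    intro x
    simpa [hst.ne'] using congrFun h0 x
  have hnz : ∀ z w : ℂ, z ≠ 0 → (z, w) ∈ triangle → extZero f (z, w) = 0 := by
    intro z w hz hp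
    have hw : 0 < ‖w‖ := (norm_nonneg z).trans_lt hp.1
    have hz' : 0 < ‖z‖ := norm_pos_iff.2 hz
    obtain ⟨a, ha⟩ := exists_toCircle hz
    obtain ⟨b, hb⟩ := exists_toCircle (norm_pos_iff.1 hw)
    have := hm (‖z‖ / ‖w‖) ⟨by positivity, (div_lt_one hw).2 hp.1⟩ ‖w‖ ⟨hw, hp.2⟩ ![a, b]
    simp only [slice, Matrix.cons_val_zero, Matrix.cons_val_one, ← hb] at this
    rwa [← Complex.ofReal_mul, div_mul_cancel₀ _ hw.ne', ← ha] at this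
  refine DFunLike.ext _ _ fun p => ?_
  obtain ⟨⟨z, w⟩, hp⟩ := p
  change (f : triangle → ℂ) ⟨(z, w), hp⟩ = 0
  rw [← extZero_of_mem f hp]
  by_cases hz : z = 0
  · subst hz
    have hcont : ContinuousAt (fun z : ℂ => extZero f (z, w)) 0 :=
      (f.coe_mem.1.continuousOn.continuousAt (isOpen_triangle.mem_nhds hp)).comp
        (f := fun z : ℂ => (z, w)) (by fun_prop)
    have hev : ∀ᶠ z in 𝓝[≠] (0 : ℂ), extZero f (z, w) = 0 := by
      have h1 : ∀ᶠ z in 𝓝 (0 : ℂ), (z, w) ∈ triangle :=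
        (show Continuous fun z : ℂ => (z, w) by fun_prop).continuousAt.eventually
          (isOpen_triangle.mem_nhds hp)
      filter_upwards [h1.filter_mono nhdsWithin_le_nhds, self_mem_nhdsWithin] with z h2 h3
      exact hnz z w h3 h2
    refine tendsto_nhds_unique (hcont.tendsto.mono_left nhdsWithin_le_nhds) ?_ (l := 𝓝[≠] (0 : ℂ))
    exact tendsto_const_nhds.congr' (hev.mono fun _ h => h.symm)
  · exact hnz z w hz hp

lemma tendsto_innerMean (f g : HardySpace) :
    Tendsto (fun p : ℝ × ℝ => innerMean f g p.1 p.2) toOne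
      (𝓝 (inner ℂ (coeffMap f) (coeffMap g))) := by
  rw [lp.inner_eq_tsum]
  have hb : Summable fun α => ‖coeff f α‖ * ‖coeff g α‖ := by
    refine Summable.of_nonneg_of_le (fun _ => by positivity) (fun α => ?_)
      ((summable_coeff f.2).add (summable_coeff g.2))
    show _ ≤ ‖coeff f α‖ ^ 2 + ‖coeff g α‖ ^ 2
    nlinarith [sq_nonneg (‖coeff f α‖ - ‖coeff g α‖), norm_nonneg (coeff f α),
      norm_nonneg (coeff g α)]
  have h := tendsto_tsum_of_dominated_convergence (𝓕 := toOne)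
    (f := fun (p : ℝ × ℝ) α => conj (coeff f α) * coeff g α * (weight α p.1 p.2 : ℂ))
    (g := fun α => inner ℂ (coeffMap f α) (coeffMap g α)) hb
    (fun α => by
      have := ((Complex.continuous_ofReal.tendsto 1).comp (tendsto_weight α)).const_mul
        (conj (coeff f α) * coeff g α)
      simp only [Complex.ofReal_one, mul_one] at this
      rw [RCLike.inner_apply']
      exact this)
    (eventually_toOne.mono fun p hp α => by
      by_cases hα : α ∈ indexSet
      · have h1 := weight_le_one hα hp.1 hp.2
        have h2 := weight_nonneg α hp.1 hp.2
        simp only [norm_mul, RCLike.norm_conj, Complex.norm_real, Real.norm_eq_abs, abs_of_nonneg h2]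
        exact mul_le_of_le_one_right (by positivity) h1
      · simp [coeff_eq_zero f.coe_mem hα])
  refine h.congr' (eventually_toOne.mono fun p hp => ?_)
  exact (hasSum_innerMean f.2.1 g.2.1 hp.1 hp.2).tsum_eq

/-! ### The Hilbert space structure -/

/-- The inner product of the Hardy space, conjugate-linear in the first variable: the limit of the
weighted integrals as `s, t → 1`. -/
def innerProd (f g : HardySpace) : ℂ := limUnder toOne fun p : ℝ × ℝ => innerMean f g p.1 p.2

lemma innerProd_eq (f g : HardySpace) : innerProd f g = inner ℂ (coeffMap f) (coeffMap g) :=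
  (tendsto_innerMean f g).limUnder_eq

@[reducible]
def innerCore : InnerProductSpace.Core ℂ HardySpace where
  inner := innerProd
  conj_inner_symm f g := by simp only [innerProd_eq]; exact inner_conj_symm _ _
  re_inner_nonneg f := by simp only [innerProd_eq]; exact inner_self_nonneg
  add_left f g h := by simp only [innerProd_eq, map_add, inner_add_left]
  smul_left f g c := by simp only [innerProd_eq, map_smul, inner_smul_left]
  definite f hf := by
    simp only [innerProd_eq, inner_self_eq_zero] at hf
    exact coeffMap_injective (hf.trans (map_zero _).symm)

instance : NormedAddCommGroup HardySpace := innerCore.toNormedAddCommGroup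

instance : InnerProductSpace ℂ HardySpace := InnerProductSpace.ofCore innerCore.toCore

lemma inner_eq (f g : HardySpace) : inner ℂ f g = inner ℂ (coeffMap f) (coeffMap g) :=
  innerProd_eq f g

lemma norm_coeffMap (f : HardySpace) : ‖coeffMap f‖ = ‖f‖ := by
  rw [@norm_eq_sqrt_re_inner ℂ, @norm_eq_sqrt_re_inner ℂ _ _ _ _ f, inner_eq]

/-- The exponents of the monomial `w⁻¹ * (z / w) ^ m * w ^ n`. -/
def idx (p : ℕ × ℕ) : Fin 2 → ℤ := ![p.1, p.2 - 1 - p.1]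

lemma idx_injective : Function.Injective idx := by
  rintro ⟨m, n⟩ ⟨m', n'⟩ h
  have h0 := congrFun h 0
  have h1 := congrFun h 1
  simp [idx] at h0 h1
  ext <;> simp <;> lia

lemma mem_range_idx {α : Fin 2 → ℤ} (hα : α ∈ indexSet) : α ∈ range idx := by
  refine ⟨((α 0).toNat, (α 0 + α 1 + 1).toNat), ?_⟩
  have h1 := hα.1
  have h2 := hα.2
  ext i
  fin_cases i
  · simp [idx, h1]
  · simp [idx, h1, h2]

lemma differentiableOn_powerSeries {b : ℕ × ℕ → ℂ} {B : ℝ} (hb : ∀ p, ‖b p‖ ≤ B) :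
    DifferentiableOn ℂ (fun u : ℂ × ℂ => ∑' p, b p * (u.1 ^ p.1 * u.2 ^ p.2)) (Metric.ball 0 1) := by
  intro u hu
  obtain ⟨r, hr1, hr2⟩ := exists_between (show ‖u‖ < 1 by simpa using hu)
  have hr0 : 0 ≤ r := (norm_nonneg u).trans hr1.le
  have hB : 0 ≤ B := (norm_nonneg _).trans (hb 0)
  have g0 : Summable fun n : ℕ => r ^ n := summable_geometric_of_lt_one hr0 hr2
  have g1 : Summable fun n : ℕ => (n : ℝ) * r ^ (n - 1) := by
    rw [← summable_nat_add_iff 1]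
    have h1 := summable_pow_mul_geometric_of_norm_lt_one (R := ℝ) 1 (r := r)
      (by rwa [Real.norm_of_nonneg hr0])
    refine (h1.add g0).congr fun n => ?_
    simp; ring
  have hsum : Summable fun p : ℕ × ℕ =>
      B * (r ^ p.1 * ((p.2 : ℝ) * r ^ (p.2 - 1)) + r ^ p.2 * ((p.1 : ℝ) * r ^ (p.1 - 1))) := by
    refine Summable.mul_left B (Summable.add ?_ ?_)
    · exact g0.mul_of_nonneg g1 (fun _ => by positivity) (fun _ => by positivity)
    · exact (g1.mul_of_nonneg g0 (fun _ => by positivity) (fun _ => by positivity)).congr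
        fun p => mul_comm _ _
  refine (hasFDerivAt_tsum_of_isPreconnected (f := fun (p : ℕ × ℕ) (u : ℂ × ℂ) =>
      b p * (u.1 ^ p.1 * u.2 ^ p.2))
    (f' := fun p x => b p • (x.1 ^ p.1 • (((p.2 : ℂ) * x.2 ^ (p.2 - 1)) •
      ContinuousLinearMap.snd ℂ ℂ ℂ) + x.2 ^ p.2 • (((p.1 : ℂ) * x.1 ^ (p.1 - 1)) •
      ContinuousLinearMap.fst ℂ ℂ ℂ))) (s := Metric.ball 0 r) hsum Metric.isOpen_ball
    (convex_ball _ _).isPreconnected (fun p x _ => ?_) (fun p x hx => ?_)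
    (Metric.mem_ball_self (by linarith [norm_nonneg u])) ?_
    (show u ∈ Metric.ball 0 r by simpa using hr1)).differentiableAt.differentiableWithinAt
  · exact (((hasDerivAt_pow p.1 x.1).comp_hasFDerivAt x hasFDerivAt_fst).mul
      ((hasDerivAt_pow p.2 x.2).comp_hasFDerivAt x hasFDerivAt_snd)).const_mul (b p)
  · have hx' : ‖x‖ < r := by simpa using hx
    have h1 : ‖x.1‖ ≤ r := (norm_fst_le x).trans hx'.le
    have h2 : ‖x.2‖ ≤ r := (norm_snd_le x).trans hx'.le
    have k1 := ContinuousLinearMap.norm_fst_le ℂ ℂ ℂ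
    have k2 := ContinuousLinearMap.norm_snd_le ℂ ℂ ℂ
    rw [norm_smul]
    refine mul_le_mul (hb p) ((norm_add_le _ _).trans (add_le_add ?_ ?_)) (norm_nonneg _) hB
    · rw [norm_smul, norm_smul, norm_mul, norm_pow, norm_pow, Complex.norm_natCast]
      have : ‖x.1‖ ^ p.1 * (p.2 * ‖x.2‖ ^ (p.2 - 1) * ‖ContinuousLinearMap.snd ℂ ℂ ℂ‖) ≤
        r ^ p.1 * (p.2 * r ^ (p.2 - 1) * 1) := by gcongr
      simpa using this
    · rw [norm_smul, norm_smul, norm_mul, norm_pow, norm_pow, Complex.norm_natCast]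
      have : ‖x.2‖ ^ p.2 * (p.1 * ‖x.1‖ ^ (p.1 - 1) * ‖ContinuousLinearMap.fst ℂ ℂ ℂ‖) ≤
        r ^ p.2 * (p.1 * r ^ (p.1 - 1) * 1) := by gcongr
      simpa using this
  · refine summable_of_ne_finset_zero (s := {0}) fun p hp => ?_
    have : p.1 ≠ 0 ∨ p.2 ≠ 0 := by
      by_contra! h; exact hp (by simp [Prod.ext_iff, h.1, h.2])
    rcases this with h | h <;> simp [h]

lemma summable_powerSeries {b : ℕ × ℕ → ℂ} {B : ℝ} (hb : ∀ p, ‖b p‖ ≤ B) {u v : ℂ} (hu : ‖u‖ < 1)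
    (hv : ‖v‖ < 1) : Summable fun p : ℕ × ℕ => b p * (u ^ p.1 * v ^ p.2) := by
  have h := (summable_geometric_of_lt_one (norm_nonneg u) hu).mul_of_nonneg
    (summable_geometric_of_lt_one (norm_nonneg v) hv) (fun _ => by positivity)
    (fun _ => by positivity)
  refine Summable.of_norm_bounded (h.mul_left B) fun p => ?_
  rw [norm_mul, norm_mul, norm_pow, norm_pow]
  exact mul_le_mul_of_nonneg_right (hb p) (by positivity)

lemma mFourierCoeff_of_hasSum {c : (Fin 2 → ℤ) → ℂ} (hc : Summable c) {F : Torus → ℂ}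
    (hF : ∀ x, HasSum (fun α => c α * UnitAddTorus.mFourier α x) (F x)) (β : Fin 2 → ℤ) :
    UnitAddTorus.mFourierCoeff F β = c β := by
  have hs : Summable fun α => c α • UnitAddTorus.mFourier α := by
    refine Summable.of_norm ?_
    simpa [norm_smul, UnitAddTorus.mFourier_norm] using hc.norm
  obtain ⟨K, hK⟩ := hs
  have hKF : F = K := by
    ext x
    refine (hF x).unique ?_
    exact (ContinuousMap.evalCLM ℂ x).hasSum hK
  have h1 := (ContinuousMap.toLp (E := ℂ) 2 torusMeasure ℂ).hasSum hK
  have h2 := (innerSL ℂ (UnitAddTorus.mFourierBasis (d := Fin 2) β)).hasSum h1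
  have h3 : (innerSL ℂ (UnitAddTorus.mFourierBasis (d := Fin 2) β))
      ((ContinuousMap.toLp (E := ℂ) 2 torusMeasure ℂ) K) = UnitAddTorus.mFourierCoeff F β := by
    rw [innerSL_apply_apply, ← HilbertBasis.repr_apply_apply, UnitAddTorus.mFourierBasis_repr, hKF]
    exact UnitAddTorus.mFourierCoeff_toLp K β
  rw [h3] at h2
  refine h2.unique ?_
  refine HasSum.congr_fun (hasSum_ite_eq β (c β)) fun α => ?_
  have := orthonormal_iff_ite.1 (UnitAddTorus.mFourierBasis (d := Fin 2)).orthonormal β α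
  rw [UnitAddTorus.coe_mFourierBasis] at this
  rw [UnitAddTorus.coe_mFourierBasis, map_smul, map_smul, innerSL_apply_apply]
  refine (congrArg (c α • ·) this).trans ?_
  by_cases h : α = β
  · simp [h]
  · simp [h, Ne.symm h]

/-- The function with prescribed coefficients. -/
def ofCoeff (a : (Fin 2 → ℤ) → ℂ) (p : triangle) : ℂ :=
  p.1.2⁻¹ * ∑' n : ℕ × ℕ, a (idx n) * ((p.1.1 / p.1.2) ^ n.1 * p.1.2 ^ n.2)

lemma isHolomorphic_ofCoeff {a : (Fin 2 → ℤ) → ℂ} {B : ℝ} (ha : ∀ α, ‖a α‖ ≤ B) :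
    IsHolomorphic (ofCoeff a) := by
  have hG := differentiableOn_powerSeries fun p => ha (idx p)
  have hne : ∀ p ∈ triangle, p.2 ≠ 0 := fun p hp h => by
    have := hp.1
    rw [h, norm_zero] at this
    exact absurd this (not_lt.2 (norm_nonneg _))
  have h2 : DifferentiableOn ℂ (fun p : ℂ × ℂ => (p.1 / p.2, p.2)) triangle := fun p hp => by
    have := hne p hp
    simp only [div_eq_mul_inv]
    fun_prop (disch := assumption)
  have h3 : DifferentiableOn ℂ (fun p : ℂ × ℂ => p.2⁻¹) triangle := fun p hp => by
    have := hne p hp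
    fun_prop (disch := assumption)
  refine (h3.mul (hG.comp h2 fun p hp => ?_)).congr fun p hp => extZero_of_mem _ hp
  have hw : 0 < ‖p.2‖ := (norm_nonneg _).trans_lt hp.1
  simp only [Metric.mem_ball, dist_zero_right, Prod.norm_def, norm_div, sup_lt_iff]
  exact ⟨(div_lt_one hw).2 hp.1, hp.2⟩

lemma coeff_ofCoeff {a : (Fin 2 → ℤ) → ℂ} {B : ℝ} (ha : ∀ α, ‖a α‖ ≤ B)
    (h0 : ∀ α ∉ indexSet, a α = 0) (β : Fin 2 → ℤ) : coeff (ofCoeff a) β = a β := by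
  have h2 : (2⁻¹ : ℝ) ∈ Ioo (0 : ℝ) 1 := by constructor <;> norm_num
  have hn : ((2⁻¹ : ℝ) : ℂ) ≠ 0 := by norm_num
  have hn1 : ‖((2⁻¹ : ℝ) : ℂ)‖ < 1 := by norm_num
  set r : ℂ := ((2⁻¹ : ℝ) : ℂ) with hr
  set c : (Fin 2 → ℤ) → ℂ := fun α => a α * (r ^ α 0 * r ^ (α 0 + α 1)) with hcdef
  have hc0 : ∀ α ∉ range idx, c α = 0 := fun α hα => by
    simp [hcdef, h0 α fun h => hα (mem_range_idx h)]
  have hcidx : ∀ p : ℕ × ℕ, c (idx p) = r⁻¹ * (a (idx p) * (r ^ p.1 * r ^ p.2)) := by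
    intro p
    have : idx p 0 + idx p 1 = p.2 - 1 := by simp [idx]
    simp only [hcdef, this]
    rw [zpow_sub₀ hn]
    simp [idx]
    ring
  have hcs : Summable c := by
    rw [← idx_injective.summable_iff hc0]
    exact ((summable_powerSeries (fun p => ha (idx p)) hn1 hn1).mul_left r⁻¹).congr
      fun p => (hcidx p).symm
  have key := mFourierCoeff_of_hasSum hcs (F := slice (ofCoeff a) 2⁻¹ 2⁻¹) (fun x => ?_) β
  · rw [coeff, key, ← hr]
    simp only [hcdef, zpow_neg]
    have a1 := zpow_ne_zero (β 0) hn
    have a2 := zpow_ne_zero (β 0 + β 1) hn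
    field_simp
  · rw [slice_apply _ h2 h2, ← idx_injective.hasSum_iff (fun α hα => by rw [hc0 α hα, zero_mul])]
    have e0 : ((x 0).toCircle : ℂ) ≠ 0 := Circle.coe_ne_zero _
    have e1 : ((x 1).toCircle : ℂ) ≠ 0 := Circle.coe_ne_zero _
    have hu : ‖r * r * ((x 0).toCircle : ℂ) / (r * ((x 1).toCircle : ℂ))‖ < 1 := by
      simp only [norm_mul, norm_div, Circle.norm_coe, mul_one]
      rw [mul_div_cancel_right₀ _ (by simpa using hn)]
      exact hn1
    have hv : ‖r * ((x 1).toCircle : ℂ)‖ < 1 := by rwa [norm_mul, Circle.norm_coe, mul_one]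
    refine HasSum.congr_fun ((summable_powerSeries (fun p => ha (idx p)) hu hv).hasSum.mul_left
      (r * ((x 1).toCircle : ℂ))⁻¹) fun p => ?_
    simp only [Function.comp_apply, hcidx]
    have e2 : UnitAddTorus.mFourier (idx p) x =
        ((x 0).toCircle : ℂ) ^ p.1 * (((x 1).toCircle : ℂ) ^ p.2 *
          ((x 1).toCircle : ℂ)⁻¹ * (((x 1).toCircle : ℂ) ^ p.1)⁻¹) := by
      simp only [UnitAddTorus.mFourier, ContinuousMap.coe_mk, Fin.prod_univ_two, fourier_apply,
        AddCircle.toCircle_zsmul, idx, Matrix.cons_val_zero, Matrix.cons_val_one, Circle.coe_zpow]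
      rw [zpow_sub₀ e1, zpow_sub₀ e1]
      simp [div_eq_mul_inv]
    rw [e2, mul_assoc r r, mul_div_mul_left _ _ hn, div_pow, mul_pow, mul_pow]
    field_simp

lemma ofCoeff_mem {a : lp (fun _ : Fin 2 → ℤ => ℂ) 2} (h0 : ∀ α ∉ indexSet, a α = 0) :
    ofCoeff a ∈ hardySubspace := by
  have ha : ∀ α, ‖a α‖ ≤ ‖a‖ := lp.norm_apply_le_norm (by norm_num) a
  have hol := isHolomorphic_ofCoeff ha
  have hs : Summable fun α => ‖a α‖ ^ 2 := by
    simpa using (lp.memℓp a).summable (by norm_num)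
  refine ⟨hol, ∑' α, ‖a α‖ ^ 2, fun s hs' t ht => ?_⟩
  refine hasSum_le (fun α => ?_) (hasSum_mean hol hs' ht) hs.hasSum
  rw [coeff_ofCoeff ha h0]
  by_cases hα : α ∈ indexSet
  · exact mul_le_of_le_one_right (by positivity) (weight_le_one hα hs' ht)
  · simp [h0 α hα]

lemma range_coeffMap : range coeffMap = {a | ∀ α ∉ indexSet, a α = 0} := by
  ext a
  constructor
  · rintro ⟨f, rfl⟩ α hα
    exact coeff_eq_zero f.coe_mem hα
  · intro h0
    refine ⟨⟨ofCoeff a, ofCoeff_mem h0⟩, ?_⟩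
    ext α
    exact coeff_ofCoeff (lp.norm_apply_le_norm (by norm_num) a) h0 α

instance : CompleteSpace HardySpace := by
  have hiso : Isometry coeffMap := AddMonoidHomClass.isometry_of_norm _ norm_coeffMap
  refine hiso.isUniformInducing.completeSpace ?_
  rw [range_coeffMap]
  refine IsClosed.isComplete ?_
  simp only [ofPred_forall]
  refine isClosed_iInter fun α => isClosed_iInter fun _ => isClosed_eq ?_ continuous_const
  exact (lp.evalCLM ℂ (fun _ : Fin 2 → ℤ => ℂ) 2 α).continuous

/-- The squared norm is the supremum of the integral means. -/
theorem isLUB_norm_sq (f : HardySpace) :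
    IsLUB {m | ∃ s ∈ Ioo (0 : ℝ) 1, ∃ t ∈ Ioo (0 : ℝ) 1, m = mean f s t} (‖f‖ ^ 2) := by
  have hT : Tendsto (fun p : ℝ × ℝ => mean f p.1 p.2) toOne (𝓝 (‖f‖ ^ 2)) := by
    have h := (Complex.continuous_re.tendsto _).comp (tendsto_innerMean f f)
    rw [← inner_eq, inner_self_eq_norm_sq_to_K] at h
    simp only [Function.comp_def, innerMean_self, Complex.ofReal_re] at h
    convert h using 2
    norm_cast
  have hn : ‖f‖ ^ 2 = ∑' α, ‖coeff f α‖ ^ 2 := by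
    rw [← norm_coeffMap]
    simpa [coeffMap_apply] using lp.norm_rpow_eq_tsum (p := 2) (by norm_num) (coeffMap f)
  refine ⟨?_, fun b hb => le_of_tendsto hT (eventually_toOne.mono fun p hp =>
    hb ⟨_, hp.1, _, hp.2, rfl⟩)⟩
  rintro _ ⟨s, hs, t, ht, rfl⟩
  rw [hn]
  refine hasSum_le (fun α => ?_) (hasSum_mean f.coe_mem.1 hs ht) (summable_coeff f.coe_mem).hasSum
  by_cases hα : α ∈ indexSet
  · exact mul_le_of_le_one_right (by positivity) (weight_le_one hα hs ht)
  · simp [coeff_eq_zero f.coe_mem hα]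

/-! ### Multiplication operators and submodules -/

lemma extZero_mul (f g : triangle → ℂ) : extZero (f * g) = extZero f * extZero g := by
  ext p
  by_cases hp : p ∈ triangle
  · simp [extZero_of_mem _ hp]
  · have : ¬ ∃ a : triangle, a.1 = p := by rintro ⟨a, rfl⟩; exact hp a.2
    simp [extZero, Function.extend_apply' _ _ _ this]

lemma mean_mul_le {h f : triangle → ℂ} (hh : IsHolomorphic h) (hb : ∀ p, ‖h p‖ ≤ 1)
    (hf : IsHolomorphic f) {s t : ℝ} (hs : s ∈ Ioo (0 : ℝ) 1) (ht : t ∈ Ioo (0 : ℝ) 1) :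
    mean (h * f) s t ≤ mean f s t := by
  have hhf : IsHolomorphic (h * f) := by rw [IsHolomorphic, extZero_mul]; exact hh.mul hf
  have c1 := continuous_slice hhf hs ht
  have c2 := continuous_slice hf hs ht
  refine integral_mono (integrable_of_continuous (by fun_prop))
    (integrable_of_continuous (by fun_prop)) fun x => ?_
  have h0 : 0 ≤ s * t ^ 2 := by have := hs.1; positivity
  have h1 : ‖slice (h * f) s t x‖ ≤ ‖slice f s t x‖ := by
    rw [slice_apply _ hs ht, slice_apply _ hs ht, Pi.mul_apply, norm_mul]
    exact mul_le_of_le_one_left (norm_nonneg _) (hb _)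
  gcongr

/-- Multiplication by a holomorphic function bounded by one. -/
def mulOp (h : triangle → ℂ) (hh : IsHolomorphic h) (hb : ∀ p, ‖h p‖ ≤ 1) :
    HardySpace →L[ℂ] HardySpace :=
  LinearMap.mkContinuous
    { toFun := fun f => ⟨h * f, by
        rw [IsHolomorphic, extZero_mul]; exact hh.mul f.coe_mem.1,
          f.coe_mem.2.imp fun _ hC s hs t ht => (mean_mul_le hh hb f.coe_mem.1 hs ht).trans (hC s hs t ht)⟩
      map_add' := fun f g => Subtype.ext (mul_add h f.1 g.1)
      map_smul' := fun c f => Subtype.ext (mul_smul_comm c h f.1) } 1 (by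
    intro f
    rw [one_mul, ← sq_le_sq₀ (norm_nonneg _) (norm_nonneg _)]
    refine (isLUB_norm_sq _).2 ?_
    rintro _ ⟨s, hs, t, ht, rfl⟩
    exact (mean_mul_le hh hb f.coe_mem.1 hs ht).trans ((isLUB_norm_sq f).1 ⟨s, hs, t, ht, rfl⟩))

lemma isHolomorphic_of_differentiable {F : ℂ × ℂ → ℂ} (hF : Differentiable ℂ F) :
    IsHolomorphic fun p => F p :=
  hF.differentiableOn.congr fun _ hp => extZero_of_mem _ hp

/-- Multiplication by the first coordinate. -/
def Mz : HardySpace →L[ℂ] HardySpace :=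
  mulOp (fun p => p.1.1) (isHolomorphic_of_differentiable differentiable_fst)
    fun p => (p.2.1.trans p.2.2).le

/-- Multiplication by the second coordinate. -/
def Mw : HardySpace →L[ℂ] HardySpace :=
  mulOp (fun p => p.1.2) (isHolomorphic_of_differentiable differentiable_snd) fun p => p.2.2.le

theorem Mz_apply (f : HardySpace) (p : triangle) : Mz f p = p.1.1 * f p := rfl

theorem Mw_apply (f : HardySpace) (p : triangle) : Mw f p = p.1.2 * f p := rfl

/-- A submodule of the Hardy space: a closed subspace invariant under `Mz` and `Mw`. -/
structure HardySubmodule extends Submodule ℂ HardySpace where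
  isClosed' : IsClosed (toSubmodule : Set HardySpace)
  Mz_mem' : ∀ f ∈ toSubmodule, Mz f ∈ toSubmodule
  Mw_mem' : ∀ f ∈ toSubmodule, Mw f ∈ toSubmodule

namespace HardySubmodule

instance (S : HardySubmodule) : CompleteSpace S.toSubmodule :=
  S.isClosed'.completeSpace_coe

/-- The restriction of `Mz` to the submodule. -/
def Sz (S : HardySubmodule) : S.toSubmodule →L[ℂ] S.toSubmodule := Mz.restrict S.Mz_mem'

/-- The restriction of `Mw` to the submodule. -/
def Sw (S : HardySubmodule) : S.toSubmodule →L[ℂ] S.toSubmodule := Mw.restrict S.Mw_mem'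

/-- `[S_z*, S_w] = 0`. -/
def IsDoublyCommuting (S : HardySubmodule) : Prop :=
  ⁅ContinuousLinearMap.adjoint S.Sz, S.Sw⁆ = 0

end HardySubmodule

/-- The functions in the Hardy space that are sums of a power series `∑ a_{ij} z ^ i w ^ j` with
`i, j ≥ 0`. -/
def hardyPlus : Set HardySpace :=
  {f | ∃ a : ℕ → ℕ → ℂ, ∀ p : triangle,
    HasSum (fun n : ℕ × ℕ => a n.1 n.2 * p.1.1 ^ n.1 * p.1.2 ^ n.2) (f p)}

/-- `F` is the boundary function of `f` on `𝕋²`: the dilates of `f` converge to `F` in `L²(𝕋²)`. -/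
def IsBoundaryFunction (f : triangle → ℂ) (F : Torus → ℂ) : Prop :=
  MemLp F 2 torusMeasure ∧
    Tendsto (fun p : ℝ × ℝ => eLpNorm (fun x => slice f p.1 p.2 x - F x) 2 torusMeasure) toOne (𝓝 0)

/-- `f` is unimodular: its boundary function has modulus one almost everywhere on `𝕋²`. -/
def IsUnimodular (f : triangle → ℂ) : Prop :=
  ∃ F : Torus → ℂ, IsBoundaryFunction f F ∧ ∀ᵐ x ∂torusMeasure, ‖F x‖ = 1

end Hartogs

end

noncomputable section

open MeasureTheory Filter Topology Set
open scoped ComplexConjugate ENNReal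

namespace Hartogs

/-! ### Doubly commuting isometries -/

section Wold

variable {K : Type*} [NormedAddCommGroup K] [InnerProductSpace ℂ K] {V U : K →L[ℂ] K}

/-! Laurent coefficients identify a function in the Hardy space isometrically with a boundary
function in `L²(𝕋²)`, on which `M_z` and `M_w` act as multiplication by the two coordinate
characters. Hence `S_z` and `S_w` are commuting isometries. They are pure because the admissible
exponents are bounded below in the relevant directions.

If they commute doubly, the Wold decomposition (`eq_zero_of_forall_inner_wandering`,
`inner_wandering`) writes `S` as the orthogonal sum of the spaces `z ^ i * w ^ j * W`, where `W =
ker S_z* ∩ ker S_w*`. For a unit vector `q` of `W` the products `z ^ i * w ^ j * q` are orthonormal.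
Their inner products are Fourier coefficients of `|q|²` on the torus, and every integer exponent is
a difference of two nonnegative ones, so `|q|²` has the Fourier coefficients of `1` and `q` is
unimodular (`isUnimodular_iff_orthonormal`). In the same way, if `g` in `W` is orthogonal to `q`,
all Fourier coefficients of `conj q * g` vanish, so `g = 0` (`eq_zero_of_inner_unimodular`). Thus
`W` is a line and `S` is the closed span of the `z ^ i * w ^ j * q`, which is `q` times the power
series with square summable coefficients.

Conversely, when `q` is unimodular these products form an orthonormal basis of `S`, on which `S_z`
and `S_w` are the two shifts of `ℓ²(ℕ²)`; these commute doubly. -/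

lemma pow_apply_mem_ker {A B : K →L[ℂ] K} (h : Commute A B) {x : K} (hx : A x = 0) (n : ℕ) :
    A ((B ^ n) x) = 0 := by
  rw [← mul_apply_eq_comp, (h.pow_right n).eq, mul_apply_eq_comp, hx, map_zero]

variable [CompleteSpace K]

open ContinuousLinearMap (adjoint adjoint_inner_left adjoint_inner_right)

/-- A vector that is orthogonal to all translates of the wandering subspace of a pure isometry
vanishes. -/
lemma eq_zero_of_pure (hV : ∀ x, (∀ n : ℕ, ∃ y, x = (V ^ n) y) → x = 0) {x : K}
    (hx : ∀ n : ℕ, (adjoint V ^ n) x = V ((adjoint V ^ (n + 1)) x)) : x = 0 := by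
  refine hV x fun n => ⟨(adjoint V ^ n) x, ?_⟩
  -- `hx` says that `(1 - V V*) V*ⁿ x = 0` for every `n`. Iterating gives `x = Vⁿ V*ⁿ x`, so `x`
  -- lies in the range of every power.
  induction n with
  | zero => simp
  | succ n ih => rw [pow_succ, mul_apply_eq_comp, ← hx n]; exact ih

/-- The Wold decomposition of a pair of doubly commuting pure isometries: the translates of the joint
wandering subspace span a dense subspace. -/
theorem eq_zero_of_forall_inner_wandering (hV : adjoint V * V = 1) (hU : adjoint U * U = 1)
    (hc : Commute V U) (hd : Commute (adjoint V) U)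
    (pV : ∀ x, (∀ n : ℕ, ∃ y, x = (V ^ n) y) → x = 0)
    (pU : ∀ x, (∀ n : ℕ, ∃ y, x = (U ^ n) y) → x = 0) {x : K}
    (hx : ∀ u, adjoint V u = 0 → adjoint U u = 0 → ∀ i j : ℕ, inner ℂ ((V ^ i) ((U ^ j) u)) x = 0) :
    x = 0 := by
  have hc' : Commute (adjoint V) (adjoint U) := hc.star_star
  have hV' : ∀ y, adjoint V (V y) = y := fun y => by rw [← mul_apply_eq_comp, hV]; rfl
  have hU' : ∀ y, adjoint U (U y) = y := fun y => by rw [← mul_apply_eq_comp, hU]; rfl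
  have adj_pow : ∀ (A : K →L[ℂ] K) (n : ℕ), adjoint (A ^ n) = adjoint A ^ n := fun A n =>
    star_pow A n
  refine eq_zero_of_pure pV fun i => ?_
  rw [← sub_eq_zero]
  -- `e = (1 - V V*) V*ⁱ x` is the `i`-th wandering component of `x` for `V`; the same construction
  -- for `U`, applied to `e`, will give a vector `u` in both kernels.
  set e := (adjoint V ^ i) x - V ((adjoint V ^ (i + 1)) x) with he
  have heV : adjoint V e = 0 := by rw [he, map_sub, hV', pow_succ', mul_apply_eq_comp, sub_self]
  refine eq_zero_of_pure pU fun j => ?_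
  rw [← sub_eq_zero]
  set u := (adjoint U ^ j) e - U ((adjoint U ^ (j + 1)) e) with hu
  have huU : adjoint U u = 0 := by rw [hu, map_sub, hU', pow_succ', mul_apply_eq_comp, sub_self]
  -- Double commutativity enters here: `ker V*` is invariant under `U` as well as under `U*`, so
  -- passing from `e` to `u` does not leave it.
  have huV : adjoint V u = 0 := by
    rw [hu, map_sub, pow_apply_mem_ker hc' heV, ← mul_apply_eq_comp, hd.eq, mul_apply_eq_comp,
      pow_apply_mem_ker hc' heV, map_zero, sub_zero]
  have hVU : adjoint V ((U ^ j) u) = 0 := pow_apply_mem_ker hd huV j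
  -- Moving adjoints across gives `⟨u, u⟩ = ⟨Uʲ u, e⟩ = ⟨Vⁱ Uʲ u, x⟩`; the subtracted terms drop out
  -- because `U* u = 0` and `V* Uʲ u = 0`.
  have key : inner ℂ u u = inner ℂ ((V ^ i) ((U ^ j) u)) x := by
    nth_rewrite 2 [hu]
    rw [inner_sub_right, ← adjoint_inner_left U, huU, inner_zero_left, sub_zero, ← adj_pow,
      adjoint_inner_right, he, inner_sub_right, ← adjoint_inner_left V, hVU, inner_zero_left,
      sub_zero, ← adj_pow, adjoint_inner_right]
  rw [hx u huV huU, inner_self_eq_zero] at key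
  exact key

/-- Cancelling the isometry `Vⁱ` on both sides leaves at least one factor `V` on the right, and its
adjoint kills `x`. -/
lemma inner_pow_apply_of_adjoint_eq_zero {x y : K} (hV : adjoint V * V = 1) (hx : adjoint V x = 0)
    {i k : ℕ} (h : i < k) : inner ℂ ((V ^ i) x) ((V ^ k) y) = 0 := by
  have adj : adjoint (V ^ i) * V ^ i = 1 := by
    rw [show adjoint (V ^ i) = adjoint V ^ i from star_pow V i]
    exact pow_mul_pow_eq_one i hV
  obtain ⟨m, rfl⟩ := Nat.exists_eq_add_of_lt h
  rw [add_assoc, pow_add, mul_apply_eq_comp, ← adjoint_inner_right, ← mul_apply_eq_comp, adj, one_apply_eq_self, pow_succ',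
    mul_apply_eq_comp, ← adjoint_inner_left, hx, inner_zero_left]

/-- The translates of the joint wandering subspace of doubly commuting isometries are
orthogonal. -/
theorem inner_wandering (hV : adjoint V * V = 1) (hU : adjoint U * U = 1)
    (hd : Commute (adjoint V) U) {x y : K} (hxV : adjoint V x = 0)
    (hxU : adjoint U x = 0) (hyV : adjoint V y = 0) (hyU : adjoint U y = 0) {i j k l : ℕ}
    (h : (i, j) ≠ (k, l)) : inner ℂ ((V ^ i) ((U ^ j) x)) ((V ^ k) ((U ^ l) y)) = 0 := by
  have comm0 : ∀ {a b : K}, inner ℂ a b = 0 → inner ℂ b a = 0 := fun h => inner_eq_zero_symm.1 h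
  rcases lt_trichotomy i k with hik | rfl | hik
  · exact inner_pow_apply_of_adjoint_eq_zero hV (pow_apply_mem_ker hd hxV j) hik
  · have hadj : adjoint (V ^ i) * V ^ i = 1 := by
      rw [show adjoint (V ^ i) = adjoint V ^ i from star_pow V i]
      exact pow_mul_pow_eq_one i hV
    rw [← adjoint_inner_right, ← mul_apply_eq_comp, hadj, one_apply_eq_self]
    rcases lt_trichotomy j l with hjl | rfl | hjl
    · exact inner_pow_apply_of_adjoint_eq_zero hU hxU hjl
    · exact absurd rfl h
    · exact comm0 (inner_pow_apply_of_adjoint_eq_zero hU hyU hjl)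
  · exact comm0 (inner_pow_apply_of_adjoint_eq_zero hV (pow_apply_mem_ker hd hyV l) hik)

end Wold

/-! ### Fourier series on the torus -/

open UnitAddTorus (mFourier mFourierCoeff mFourierBasis)

/-- The Fourier basis of `L²(𝕋²)`. -/
def torusBasis : HilbertBasis (Fin 2 → ℤ) ℂ (Lp ℂ 2 torusMeasure) := mFourierBasis

lemma torusBasis_repr (F : Lp ℂ 2 torusMeasure) (α : Fin 2 → ℤ) :
    torusBasis.repr F α = mFourierCoeff F α :=
  UnitAddTorus.mFourierBasis_repr F α

lemma mFourierCoeff_def (F : Torus → ℂ) (α : Fin 2 → ℤ) :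
    mFourierCoeff F α = ∫ x, mFourier (-α) x * F x ∂torusMeasure := rfl

lemma norm_mFourier_apply (α : Fin 2 → ℤ) (x : Torus) : ‖mFourier α x‖ = 1 := by
  simp only [mFourier, ContinuousMap.coe_mk, norm_prod, fourier_apply, Circle.norm_coe,
    Finset.prod_const_one]

lemma mFourierCoeff_congr_ae {F G : Torus → ℂ} (h : F =ᵐ[torusMeasure] G) (α : Fin 2 → ℤ) :
    mFourierCoeff F α = mFourierCoeff G α := by
  rw [mFourierCoeff_def, mFourierCoeff_def]
  refine integral_congr_ae ?_
  filter_upwards [h] with x hx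
  rw [hx]

lemma torusBasis_repr_toLp {F : Torus → ℂ} (hF : MemLp F 2 torusMeasure) (α : Fin 2 → ℤ) :
    torusBasis.repr (hF.toLp F) α = mFourierCoeff F α := by
  rw [torusBasis_repr]
  exact mFourierCoeff_congr_ae hF.coeFn_toLp α

lemma ae_eq_of_mFourierCoeff_eq {F G : Torus → ℂ} (hF : MemLp F 2 torusMeasure)
    (hG : MemLp G 2 torusMeasure) (h : ∀ α, mFourierCoeff F α = mFourierCoeff G α) :
    F =ᵐ[torusMeasure] G := by
  have : hF.toLp F = hG.toLp G := by
    refine torusBasis.repr.injective (lp.ext (funext fun α => ?_))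
    rw [torusBasis_repr_toLp, torusBasis_repr_toLp, h]
  exact (MemLp.toLp_eq_toLp_iff hF hG).1 this

/-- Parseval for the difference. It reduces convergence to a boundary function to the convergence of
a series in the coefficients. -/
lemma eLpNorm_sub_eq {F G : Torus → ℂ} (hF : MemLp F 2 torusMeasure)
    (hG : MemLp G 2 torusMeasure) :
    eLpNorm (fun x => F x - G x) 2 torusMeasure =
      ENNReal.ofReal (√(∑' α, ‖mFourierCoeff F α - mFourierCoeff G α‖ ^ 2)) := by
  have h1 : ‖hF.toLp F - hG.toLp G‖ ^ 2 = ∑' α, ‖mFourierCoeff F α - mFourierCoeff G α‖ ^ 2 := by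
    rw [← torusBasis.repr.norm_map, map_sub]
    have := lp.norm_rpow_eq_tsum (p := 2) (by norm_num)
      (torusBasis.repr (hF.toLp F) - torusBasis.repr (hG.toLp G))
    simpa [torusBasis_repr_toLp] using this
  rw [← h1, Real.sqrt_sq (norm_nonneg _), ← MemLp.toLp_sub, Lp.norm_toLp, ENNReal.ofReal_toReal]
  · rfl
  · exact (hF.sub hG).eLpNorm_ne_top

lemma mFourierCoeff_mul (F : Torus → ℂ) (β α : Fin 2 → ℤ) :
    mFourierCoeff (fun x => mFourier β x * F x) α = mFourierCoeff F (α - β) := by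
  rw [mFourierCoeff_def, mFourierCoeff_def]
  congr 1; ext x
  rw [← mul_assoc, ← UnitAddTorus.mFourier_add]
  congr 3; abel

lemma memLp_mFourier_mul {F : Torus → ℂ} (hF : MemLp F 2 torusMeasure) (β : Fin 2 → ℤ) :
    MemLp (fun x => mFourier β x * F x) 2 torusMeasure := by
  refine hF.of_le ((mFourier β).continuous.aestronglyMeasurable.mul hF.1) ?_
  filter_upwards with x
  rw [norm_mul, norm_mFourier_apply, one_mul]

lemma integral_mFourier (α : Fin 2 → ℤ) :
    ∫ x, mFourier α x ∂torusMeasure = if α = 0 then 1 else 0 := by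
  have h := mFourierCoeff_of_hasSum (c := fun β => if β = 0 then 1 else 0) (F := fun _ => 1)
    (summable_of_ne_finset_zero (s := {0}) fun β hβ => by simpa using hβ)
    (fun x => by
      have := hasSum_ite_eq (0 : Fin 2 → ℤ) (1 : ℂ)
      refine HasSum.congr_fun this fun β => ?_
      by_cases hβ : β = 0
      · simp [hβ, UnitAddTorus.mFourier_zero]
      · simp [hβ]) (-α)
  simpa [mFourierCoeff_def] using h

/-- If `|F|²` has the Fourier coefficients of the constant function one, then `|F| = 1` almost
everywhere. -/
lemma ae_norm_eq_one {F : Torus → ℂ} (hF : MemLp F 2 torusMeasure)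
    (h : ∀ α, ∫ x, mFourier α x * (conj (F x) * F x) ∂torusMeasure = if α = 0 then 1 else 0) :
    ∀ᵐ x ∂torusMeasure, ‖F x‖ = 1 := by
  -- `|F|²` is only integrable, so uniqueness of Fourier coefficients in `L²` does not apply to it.
  -- Instead the measure with density `|F|²` is compared with Lebesgue measure: they agree on
  -- characters, hence on continuous functions by density of trigonometric polynomials, hence as
  -- measures.
  set ν : Measure Torus := torusMeasure.withDensity fun x => ‖F x‖ₑ ^ 2 with hν
  have hm : AEMeasurable (fun x => ‖F x‖ₑ ^ 2) torusMeasure := hF.1.enorm.pow_const 2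
  have hfin : ∫⁻ x, ‖F x‖ₑ ^ 2 ∂torusMeasure ≠ ∞ := by
    have := lintegral_rpow_enorm_lt_top_of_eLpNorm_lt_top two_ne_zero ENNReal.ofNat_ne_top hF.2
    simpa using this.ne
  have : IsFiniteMeasure ν := isFiniteMeasure_withDensity hfin
  have hint : ∀ φ : Torus → ℂ, ∫ x, φ x ∂ν = ∫ x, φ x * (conj (F x) * F x) ∂torusMeasure := by
    intro φ
    rw [hν, integral_withDensity_eq_integral_toReal_smul₀ hm]
    · congr 1; ext x
      rw [Complex.conj_mul', ENNReal.toReal_pow, toReal_enorm, Complex.real_smul]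
      push_cast; ring
    · filter_upwards with x
      simp
  -- For a finite measure the integral is continuous in the uniform norm, since it factors through
  -- `L¹`; this makes the set where the two integrals agree closed.
  have hcont : ∀ (κ : Measure Torus) [IsFiniteMeasure κ],
      Continuous fun φ : C(Torus, ℂ) => ∫ x, φ x ∂κ := by
    intro κ _
    have e : (fun φ : C(Torus, ℂ) => ∫ x, φ x ∂κ) =
        fun φ => ∫ x, ContinuousMap.toLp (E := ℂ) 1 κ ℂ φ x ∂κ := by
      ext φ
      exact integral_congr_ae (ContinuousMap.coeFn_toLp κ φ).symm
    rw [e]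
    exact continuous_integral.comp (ContinuousMap.toLp (E := ℂ) 1 κ ℂ).continuous
  have hci : ∀ (κ : Measure Torus) [IsFiniteMeasure κ] (φ : C(Torus, ℂ)), Integrable φ κ :=
    fun κ _ φ => φ.continuous.integrable_of_hasCompactSupport (HasCompactSupport.of_compactSpace _)
  have hall : ∀ φ : C(Torus, ℂ), ∫ x, φ x ∂ν = ∫ x, φ x ∂torusMeasure := by
    intro φ
    have hφ : φ ∈ (Submodule.span ℂ (range (mFourier (d := Fin 2)))).topologicalClosure := by
      rw [UnitAddTorus.span_mFourier_closure_eq_top]; trivial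
    refine closure_minimal (t := {φ : C(Torus, ℂ) | ∫ x, φ x ∂ν = ∫ x, φ x ∂torusMeasure}) ?_
      (isClosed_eq (hcont ν) (hcont torusMeasure)) hφ
    intro ψ hψ
    induction hψ using Submodule.span_induction with
    | mem ψ hψ =>
      obtain ⟨α, rfl⟩ := hψ
      simp only [mem_ofPred_eq]
      rw [hint, h, integral_mFourier]
    | zero => simp
    | add ψ₁ ψ₂ _ _ h1 h2 =>
      simp only [mem_ofPred_eq, ContinuousMap.add_apply] at *
      rw [integral_add (hci _ _) (hci _ _), integral_add (hci _ _) (hci _ _), h1, h2]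
    | smul c ψ _ h1 =>
      simp only [mem_ofPred_eq, ContinuousMap.smul_apply] at *
      rw [integral_smul, integral_smul, h1]
  have hνμ : ν = torusMeasure := by
    refine ext_of_forall_integral_eq_of_IsFiniteMeasure fun f => ?_
    have := hall ⟨fun x => (f x : ℂ), by fun_prop⟩
    simp only [ContinuousMap.coe_mk, integral_complex_ofReal] at this
    exact_mod_cast this
  have h1 : (fun x => ‖F x‖ₑ ^ 2) =ᵐ[torusMeasure] fun _ => 1 := by
    rw [← withDensity_eq_iff hm aemeasurable_const hfin]
    rw [withDensity_const, one_smul]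
    exact hνμ
  filter_upwards [h1] with x hx
  have h2 := congrArg ENNReal.toReal hx
  rw [ENNReal.toReal_pow, toReal_enorm, ENNReal.toReal_one] at h2
  exact (pow_eq_one_iff_of_nonneg (norm_nonneg _) two_ne_zero).1 h2

/-! ### Boundary functions -/

/-- The boundary function of a function in the Hardy space. -/
def boundary (f : HardySpace) : Lp ℂ 2 torusMeasure := torusBasis.repr.symm (coeffMap f)

lemma mFourierCoeff_boundary (f : HardySpace) (α : Fin 2 → ℤ) :
    mFourierCoeff (boundary f) α = coeff f α := by
  rw [← torusBasis_repr, boundary, LinearIsometryEquiv.apply_symm_apply, coeffMap_apply]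

/-- Both the coefficient map and the Fourier expansion on the torus preserve inner products. -/
lemma inner_eq_integral_boundary (f g : HardySpace) :
    inner ℂ f g = ∫ x, conj (boundary f x) * boundary g x ∂torusMeasure := by
  rw [inner_eq, ← torusBasis.repr.symm.inner_map_map, L2.inner_def]
  congr 1; ext x
  rw [RCLike.inner_apply']; rfl

/-- This is the factor by which passing to the dilate with parameters `(s, t)` multiplies the
coefficient of index `α`. -/
lemma tendsto_zpow_mul_zpow (α : Fin 2 → ℤ) :
    Tendsto (fun p : ℝ × ℝ => (p.1 : ℂ) ^ α 0 * (p.2 : ℂ) ^ (α 0 + α 1)) toOne (𝓝 1) := by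
  have h : Tendsto (fun p : ℝ × ℝ => (p.1 : ℂ) ^ α 0 * (p.2 : ℂ) ^ (α 0 + α 1))
      (𝓝 ((1 : ℝ), (1 : ℝ))) (𝓝 (((1 : ℝ) : ℂ) ^ α 0 * ((1 : ℝ) : ℂ) ^ (α 0 + α 1))) := by
    refine ContinuousAt.tendsto (x := ((1 : ℝ), (1 : ℝ))) ?_
    refine ContinuousAt.mul ?_ ?_
    · exact ContinuousAt.zpow₀ (by fun_prop) _ (Or.inl (by simp))
    · exact ContinuousAt.zpow₀ (by fun_prop) _ (Or.inl (by simp))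
  simp only [Complex.ofReal_one, one_zpow, mul_one] at h
  refine h.mono_left ?_
  rw [nhds_prod_eq]
  exact Filter.prod_mono nhdsWithin_le_nhds nhdsWithin_le_nhds

lemma memLp_slice {f : triangle → ℂ} (hf : IsHolomorphic f) {s t : ℝ}
    (hs : s ∈ Ioo (0 : ℝ) 1) (ht : t ∈ Ioo (0 : ℝ) 1) : MemLp (slice f s t) 2 torusMeasure :=
  (continuous_slice hf hs ht).memLp_of_hasCompactSupport (HasCompactSupport.of_compactSpace _)

/-- The exponent `α 0 + α 1` can be as low as `-1`, so the factor is not bounded by one; restricting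
to `t > 1/2` bounds it by `2`. -/
lemma norm_zpow_mul_zpow_le {α : Fin 2 → ℤ} (hα : α ∈ indexSet) {s t : ℝ}
    (hs : s ∈ Ioo (0 : ℝ) 1) (ht : t ∈ Ioo (2⁻¹ : ℝ) 1) :
    ‖(s : ℂ) ^ α 0 * (t : ℂ) ^ (α 0 + α 1)‖ ≤ 2 := by
  have ht0 : 0 < t := lt_trans (by norm_num) ht.1
  rw [norm_mul, norm_zpow, norm_zpow, Complex.norm_real, Complex.norm_real,
    Real.norm_of_nonneg hs.1.le, Real.norm_of_nonneg ht0.le]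
  have h1 : s ^ α 0 ≤ 1 := zpow_le_one₀ hs.1 hs.2.le hα.1
  have h2 : t ^ (α 0 + α 1 + 1) ≤ 1 := zpow_le_one₀ ht0 ht.2.le hα.2
  have h3 : t ^ (α 0 + α 1) ≤ 2 := by
    rw [zpow_add_one₀ ht0.ne'] at h2
    have : 0 < t ^ (α 0 + α 1) := by positivity
    nlinarith [ht.1]
  have h4 : 0 < s ^ α 0 := zpow_pos hs.1 _
  nlinarith [zpow_pos ht0 (α 0 + α 1)]

/-- By Parseval the squared distance from the dilate to `boundary f` is a series whose terms each
tend to zero, and dominated convergence applies. -/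
theorem isBoundaryFunction_boundary (f : HardySpace) : IsBoundaryFunction f (boundary f) := by
  refine ⟨Lp.memLp _, ?_⟩
  have hlim : Tendsto (fun p : ℝ × ℝ => ∑' α,
      ‖coeff f α * ((p.1 : ℂ) ^ α 0 * (p.2 : ℂ) ^ (α 0 + α 1)) - coeff f α‖ ^ 2) toOne
      (𝓝 (∑' _ : Fin 2 → ℤ, (0 : ℝ))) := by
    -- The constant `9` is `(2 + 1) ^ 2`: the dilation factor is at most `2`, and the coefficient
    -- itself is subtracted.
    refine tendsto_tsum_of_dominated_convergence ((summable_coeff f.coe_mem).mul_left 9)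
      (fun α => ?_) ?_
    · have := (((tendsto_zpow_mul_zpow α).const_mul (coeff f α)).sub_const (coeff f α)).norm.pow 2
      simpa using this
    · have h2 : ∀ᶠ p in toOne, p.1 ∈ Ioo (0 : ℝ) 1 ∧ p.2 ∈ Ioo (2⁻¹ : ℝ) 1 := by
        have a : ∀ᶠ s in 𝓝[<] (1 : ℝ), s ∈ Ioo (0 : ℝ) 1 := Ioo_mem_nhdsLT one_pos
        have b : ∀ᶠ s in 𝓝[<] (1 : ℝ), s ∈ Ioo (2⁻¹ : ℝ) 1 := Ioo_mem_nhdsLT (by norm_num)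
        exact a.prod_mk b
      filter_upwards [h2] with p hp α
      by_cases hα : α ∈ indexSet
      · have h3 := norm_zpow_mul_zpow_le hα hp.1 hp.2
        rw [Real.norm_of_nonneg (by positivity)]
        have h4 : ‖coeff f α * ((p.1 : ℂ) ^ α 0 * (p.2 : ℂ) ^ (α 0 + α 1)) - coeff f α‖ ≤
            3 * ‖coeff f α‖ := by
          refine (norm_sub_le _ _).trans ?_
          rw [norm_mul]
          nlinarith [norm_nonneg (coeff f α)]
        nlinarith [norm_nonneg (coeff f α *
          ((p.1 : ℂ) ^ α 0 * (p.2 : ℂ) ^ (α 0 + α 1)) - coeff f α)]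
      · simp [coeff_eq_zero f.coe_mem hα]
  rw [tsum_zero] at hlim
  have h5 := ENNReal.tendsto_ofReal ((Real.continuous_sqrt.tendsto 0).comp hlim)
  rw [Real.sqrt_zero, ENNReal.ofReal_zero] at h5
  refine h5.congr' (eventually_toOne.mono fun p hp => ?_)
  beta_reduce
  rw [eLpNorm_sub_eq (memLp_slice f.coe_mem.1 hp.1 hp.2) (Lp.memLp _)]
  simp only [Function.comp_apply, mFourierCoeff_boundary,
    mFourierCoeff_slice f.coe_mem.1 _ hp.1 hp.2, mul_assoc]

lemma IsBoundaryFunction.ae_eq {f : triangle → ℂ} (hf : IsHolomorphic f) {F G : Torus → ℂ}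
    (hF : IsBoundaryFunction f F) (hG : IsBoundaryFunction f G) : F =ᵐ[torusMeasure] G := by
  have h0 : eLpNorm (F - G) 2 torusMeasure ≤ 0 := by
    have := hF.2.add hG.2
    rw [add_zero] at this
    refine ge_of_tendsto this (eventually_toOne.mono fun p hp => ?_)
    have hm := (memLp_slice hf hp.1 hp.2).1
    have e : F - G = (fun x => slice f p.1 p.2 x - G x) - fun x => slice f p.1 p.2 x - F x := by
      ext x; simp
    rw [e, add_comm]
    exact eLpNorm_sub_le (hm.sub hG.1.1) (hm.sub hF.1.1) (by norm_num)
  have h1 := (eLpNorm_eq_zero_iff (hF.1.1.sub hG.1.1) two_ne_zero).1 (le_antisymm h0 bot_le)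
  filter_upwards [h1] with x hx
  exact sub_eq_zero.1 hx

/-- Boundary functions are unique almost everywhere, so the modulus can be tested on the one built
from the coefficients. -/
lemma isUnimodular_iff (f : HardySpace) :
    IsUnimodular f ↔ ∀ᵐ x ∂torusMeasure, ‖boundary f x‖ = 1 := by
  constructor
  · rintro ⟨F, hF, h1⟩
    filter_upwards [h1, hF.ae_eq f.coe_mem.1 (isBoundaryFunction_boundary f)] with x h2 h3
    rw [← h3, h2]
  · exact fun h => ⟨_, isBoundaryFunction_boundary f, h⟩

/-! ### Multiplication by monomials -/

/-- The hypothesis says that `g = z ^ β₀ * w ^ β₁ * f` on the tori. A character shifts the Fourier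
coefficients, and the powers of the radii cancel against those in the definition of `coeff`. -/
lemma coeff_of_slice_eq {f g : triangle → ℂ} (hf : IsHolomorphic f) (hg : IsHolomorphic g)
    (β : Fin 2 → ℤ) (h : ∀ s ∈ Ioo (0 : ℝ) 1, ∀ t ∈ Ioo (0 : ℝ) 1, ∀ x,
      slice g s t x = (s : ℂ) ^ β 0 * (t : ℂ) ^ (β 0 + β 1) * (mFourier β x * slice f s t x))
    (α : Fin 2 → ℤ) : coeff g α = coeff f (α - β) := by
  have h2 : (2⁻¹ : ℝ) ∈ Ioo (0 : ℝ) 1 := by constructor <;> norm_num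
  have hr : ((2⁻¹ : ℝ) : ℂ) ≠ 0 := by norm_num
  have e : mFourierCoeff (slice g 2⁻¹ 2⁻¹) α = ((2⁻¹ : ℝ) : ℂ) ^ β 0 *
      ((2⁻¹ : ℝ) : ℂ) ^ (β 0 + β 1) * mFourierCoeff (slice f 2⁻¹ 2⁻¹) (α - β) := by
    rw [← mFourierCoeff_mul, mFourierCoeff_def, mFourierCoeff_def, ← integral_const_mul]
    congr 1; ext x
    rw [h _ h2 _ h2]; ring
  rw [mFourierCoeff_slice hf _ h2 h2, mFourierCoeff_slice hg _ h2 h2] at e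
  have e1 : (α - β) 0 + (α - β) 1 = (α 0 + α 1) - (β 0 + β 1) := by simp; ring
  rw [e1, Pi.sub_apply, zpow_sub₀ hr, zpow_sub₀ hr] at e
  have a1 := zpow_ne_zero (α 0) hr
  have a2 := zpow_ne_zero (α 0 + α 1) hr
  have a3 := zpow_ne_zero (β 0) hr
  have a4 := zpow_ne_zero (β 0 + β 1) hr
  field_simp at e
  exact e

/-- Multiplication by `z ^ i * w ^ j`. -/
def monomialMul (n : ℕ × ℕ) : HardySpace →L[ℂ] HardySpace := Mz ^ n.1 * Mw ^ n.2

/-- The exponents of `z ^ i * w ^ j`. -/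
def expo (n : ℕ × ℕ) : Fin 2 → ℤ := ![n.1, n.2]

lemma expo_injective : Function.Injective expo := by
  rintro ⟨m, n⟩ ⟨m', n'⟩ h
  have h0 := congrFun h 0
  have h1 := congrFun h 1
  simp [expo] at h0 h1
  simp [h0, h1]

lemma monomialMul_apply (n : ℕ × ℕ) (f : HardySpace) (p : triangle) :
    monomialMul n f p = p.1.1 ^ n.1 * p.1.2 ^ n.2 * f p := by
  have hz : ∀ (i : ℕ) (g : HardySpace), (Mz ^ i) g p = p.1.1 ^ i * g p := by
    intro i g
    induction i with
    | zero => simp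
    | succ i ih => rw [pow_succ', mul_apply_eq_comp, Mz_apply, ih]; ring
  have hw : ∀ (i : ℕ) (g : HardySpace), (Mw ^ i) g p = p.1.2 ^ i * g p := by
    intro i g
    induction i with
    | zero => simp
    | succ i ih => rw [pow_succ', mul_apply_eq_comp, Mw_apply, ih]; ring
  rw [monomialMul, mul_apply_eq_comp, hz, hw]; ring

lemma coeff_monomialMul (n : ℕ × ℕ) (f : HardySpace) (α : Fin 2 → ℤ) :
    coeff (monomialMul n f) α = coeff f (α - expo n) := by
  refine coeff_of_slice_eq f.coe_mem.1 (monomialMul n f).coe_mem.1 (expo n)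
    (fun s hs t ht x => ?_) α
  rw [slice_apply _ hs ht, slice_apply _ hs ht, monomialMul_apply]
  have e : mFourier (expo n) x = ((x 0).toCircle : ℂ) ^ n.1 * ((x 1).toCircle : ℂ) ^ n.2 := by
    simp [mFourier, expo, fourier_apply, AddCircle.toCircle_zsmul]
  have ht0 : (t : ℂ) ≠ 0 := by simp [ht.1.ne']
  rw [e, zpow_add₀ ht0]
  simp only [expo, Matrix.cons_val_zero, Matrix.cons_val_one, zpow_natCast]
  ring

lemma boundary_monomialMul (n : ℕ × ℕ) (f : HardySpace) :
    boundary (monomialMul n f) =ᵐ[torusMeasure] fun x => mFourier (expo n) x * boundary f x := by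
  refine ae_eq_of_mFourierCoeff_eq (Lp.memLp _) (memLp_mFourier_mul (Lp.memLp _) _) fun α => ?_
  rw [mFourierCoeff_mul, mFourierCoeff_boundary, mFourierCoeff_boundary, coeff_monomialMul]

/-- On the torus the monomials are characters, and a character times the conjugate of another is the
character of the difference. So inner products of monomial multiples are exactly the Fourier
coefficients of `conj f * g`. -/
lemma inner_monomialMul (m n : ℕ × ℕ) (f g : HardySpace) :
    inner ℂ (monomialMul m f) (monomialMul n g) =
      ∫ x, mFourier (expo n - expo m) x * (conj (boundary f x) * boundary g x) ∂torusMeasure := by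
  rw [inner_eq_integral_boundary]
  refine integral_congr_ae ?_
  filter_upwards [boundary_monomialMul m f, boundary_monomialMul n g] with x h1 h2
  rw [h1, h2, map_mul, sub_eq_add_neg, UnitAddTorus.mFourier_add, UnitAddTorus.mFourier_neg]
  ring

/-- Split into positive and negative parts. This is why nonnegative powers of `z` and `w` suffice to
see all Fourier coefficients. -/
lemma exists_expo_sub (α : Fin 2 → ℤ) : ∃ m n : ℕ × ℕ, α = expo n - expo m := by
  refine ⟨((-α 0).toNat, (-α 1).toNat), ((α 0).toNat, (α 1).toNat), ?_⟩
  ext i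
  fin_cases i <;> simp [expo]

/-- A function in the Hardy space is unimodular if and only if its products with the monomials are
orthonormal. -/
theorem isUnimodular_iff_orthonormal (q : HardySpace) :
    IsUnimodular q ↔ Orthonormal ℂ fun n => monomialMul n q := by
  rw [isUnimodular_iff, orthonormal_iff_ite]
  simp only [inner_monomialMul]
  constructor
  · intro h m n
    have e : ∫ x, mFourier (expo n - expo m) x * (conj (boundary q x) * boundary q x) ∂torusMeasure =
        ∫ x, mFourier (expo n - expo m) x ∂torusMeasure := by
      refine integral_congr_ae ?_
      filter_upwards [h] with x hx
      rw [Complex.conj_mul', hx]; simp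
    rw [e, integral_mFourier]
    simp only [sub_eq_zero, expo_injective.eq_iff, eq_comm]
  · intro h
    refine ae_norm_eq_one (Lp.memLp _) fun α => ?_
    obtain ⟨m, n, rfl⟩ := exists_expo_sub α
    rw [h m n]
    simp only [sub_eq_zero, expo_injective.eq_iff, eq_comm]

lemma boundary_eq_zero {f : HardySpace} (h : boundary f =ᵐ[torusMeasure] 0) : f = 0 := by
  refine coeffMap_injective (torusBasis.repr.symm.injective ?_)
  rw [map_zero, map_zero]
  exact (Lp.eq_zero_iff_ae_eq_zero).2 h

/-- If all products of `g` with monomials are orthogonal to all products of a unimodular function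
with monomials, then `g = 0`. -/
theorem eq_zero_of_inner_unimodular {q g : HardySpace} (hq : IsUnimodular q)
    (h : ∀ m n, inner ℂ (monomialMul m q) (monomialMul n g) = 0) : g = 0 := by
  rw [isUnimodular_iff] at hq
  -- Since `|q| = 1`, the product `conj q * g` is in `L²`, where vanishing Fourier coefficients
  -- force it to be zero.
  have hm : MemLp (fun x => conj (boundary q x) * boundary g x) 2 torusMeasure := by
    refine (Lp.memLp (boundary g)).of_le ?_ ?_
    · exact (Complex.continuous_conj.comp_aestronglyMeasurable (Lp.memLp (boundary q)).1).mul
        (Lp.memLp (boundary g)).1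
    · filter_upwards [hq] with x hx
      rw [norm_mul, RCLike.norm_conj, hx, one_mul]
  have h0 := ae_eq_of_mFourierCoeff_eq hm (MemLp.zero (ε := ℂ)) fun α => by
    obtain ⟨m, n, hα⟩ := exists_expo_sub (-α)
    rw [mFourierCoeff_def, hα, ← inner_monomialMul, h, mFourierCoeff_def]
    simp
  refine boundary_eq_zero ?_
  filter_upwards [h0, hq] with x h1 h2
  have : boundary q x ≠ 0 := by rw [← norm_ne_zero_iff, h2]; norm_num
  simpa [this] using h1

lemma inner_monomialMul_self (n : ℕ × ℕ) (f g : HardySpace) :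
    inner ℂ (monomialMul n f) (monomialMul n g) = inner ℂ f g := by
  rw [inner_monomialMul, inner_eq_integral_boundary, sub_self]
  simp [UnitAddTorus.mFourier_zero]

lemma norm_monomialMul (n : ℕ × ℕ) (f : HardySpace) : ‖monomialMul n f‖ = ‖f‖ := by
  rw [@norm_eq_sqrt_re_inner ℂ, @norm_eq_sqrt_re_inner ℂ _ _ _ _ f, inner_monomialMul_self]

lemma monomialMul_one_zero : monomialMul (1, 0) = Mz := by simp [monomialMul]

lemma monomialMul_zero_one : monomialMul (0, 1) = Mw := by simp [monomialMul]

/-! ### Point evaluations -/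

/-- The two functions have the same Laurent coefficients, which determine an element of the Hardy
space. The explicit series then bounds point values by the norm. -/
lemma apply_eq_ofCoeff (f : HardySpace) (p : triangle) : f p = ofCoeff (coeff f) p := by
  have h0 : ∀ α ∉ indexSet, coeffMap f α = 0 := fun α hα => coeff_eq_zero f.coe_mem hα
  have : (⟨ofCoeff (coeffMap f), ofCoeff_mem h0⟩ : HardySpace) = f := by
    refine coeffMap_injective (lp.ext (funext fun α => ?_))
    exact coeff_ofCoeff (lp.norm_apply_le_norm (by norm_num) _) h0 α
  exact (congrFun (congrArg (fun g : HardySpace => (g : triangle → ℂ)) this) p).symm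

/-- Evaluation at a point of the triangle, which is continuous for the Hardy norm. -/
def evalAt (p : triangle) : HardySpace →L[ℂ] ℂ :=
  LinearMap.mkContinuous
    { toFun := fun f => f p
      map_add' := fun _ _ => rfl
      map_smul' := fun _ _ => rfl }
    (‖p.1.2⁻¹‖ * ∑' n : ℕ × ℕ, ‖p.1.1 / p.1.2‖ ^ n.1 * ‖p.1.2‖ ^ n.2) (by
    intro f
    have hw : 0 < ‖p.1.2‖ := (norm_nonneg _).trans_lt p.2.1
    have hu : ‖p.1.1 / p.1.2‖ < 1 := by rw [norm_div]; exact (div_lt_one hw).2 p.2.1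
    have hs : Summable fun n : ℕ × ℕ => ‖p.1.1 / p.1.2‖ ^ n.1 * ‖p.1.2‖ ^ n.2 :=
      (summable_geometric_of_lt_one (norm_nonneg _) hu).mul_of_nonneg
        (summable_geometric_of_lt_one (norm_nonneg _) p.2.2) (fun _ => by positivity)
        (fun _ => by positivity)
    have hc : ∀ α, ‖coeff f α‖ ≤ ‖f‖ := fun α => by
      rw [← norm_coeffMap]; exact lp.norm_apply_le_norm (by norm_num) (coeffMap f) α
    change ‖f p‖ ≤ _
    rw [apply_eq_ofCoeff, ofCoeff, norm_mul, mul_assoc]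
    refine mul_le_mul_of_nonneg_left ?_ (norm_nonneg _)
    rw [mul_comm]
    refine tsum_of_norm_bounded (hs.hasSum.mul_left ‖f‖) fun n => ?_
    rw [norm_mul, norm_mul, norm_pow, norm_pow]
    exact mul_le_mul_of_nonneg_right (hc _) (by positivity))

lemma evalAt_apply (p : triangle) (f : HardySpace) : evalAt p f = f p := rfl

/-! ### Power series times a unimodular function -/

/-- The sum `∑ a_{ij} z ^ i w ^ j q` for a square summable family `a` and a function `q` whose
products with the monomials are orthonormal. -/
def seriesMul {q : HardySpace} (hq : Orthonormal ℂ fun n => monomialMul n q) :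
    lp (fun _ : ℕ × ℕ => ℂ) 2 →ₗᵢ[ℂ] HardySpace :=
  hq.orthogonalFamily.linearIsometry

lemma hasSum_seriesMul {q : HardySpace} (hq : Orthonormal ℂ fun n => monomialMul n q)
    (a : lp (fun _ : ℕ × ℕ => ℂ) 2) :
    HasSum (fun n => a n • monomialMul n q) (seriesMul hq a) :=
  hq.orthogonalFamily.hasSum_linearIsometry a

/-- Point evaluations are continuous, so the sum in norm is also a pointwise sum; there it reads as
`q` times a power series. -/
lemma hasSum_seriesMul_apply {q : HardySpace} (hq : Orthonormal ℂ fun n => monomialMul n q)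
    (a : lp (fun _ : ℕ × ℕ => ℂ) 2) (p : triangle) :
    HasSum (fun n : ℕ × ℕ => q p * (a n * p.1.1 ^ n.1 * p.1.2 ^ n.2)) (seriesMul hq a p) := by
  refine HasSum.congr_fun ((evalAt p).hasSum (hasSum_seriesMul hq a)) fun n => ?_
  rw [map_smul, evalAt_apply, monomialMul_apply, smul_eq_mul]; ring

/-- The constant function one. -/
def oneFun : HardySpace := ⟨fun _ => 1, isHolomorphic_of_differentiable (differentiable_const 1), 1,
  fun s hs t ht => by
    have h : ∀ x, ‖slice (fun _ => 1) s t x‖ ^ 2 * (s * t ^ 2) = s * t ^ 2 := fun x => by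
      rw [slice_apply _ hs ht]; simp
    have h2 : t ^ 2 ≤ 1 := pow_le_one₀ ht.1.le ht.2.le
    simp only [mean, h]
    simpa using mul_le_one₀ hs.2.le (by positivity) h2⟩

lemma oneFun_apply (p : triangle) : oneFun p = 1 := rfl

lemma isUnimodular_oneFun : IsUnimodular oneFun := by
  refine ⟨fun _ => 1, ⟨memLp_const 1, ?_⟩, by simp⟩
  refine tendsto_const_nhds.congr' (eventually_toOne.mono fun p hp => ?_)
  have : (fun x => slice oneFun p.1 p.2 x - 1) = 0 := by
    ext x
    rw [slice_apply _ hp.1 hp.2, oneFun_apply, sub_self]; rfl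
  beta_reduce
  rw [this, eLpNorm_zero]

lemma orthonormal_monomialMul_oneFun : Orthonormal ℂ fun n => monomialMul n oneFun :=
  (isUnimodular_iff_orthonormal _).1 isUnimodular_oneFun

/-- On a single torus the power series is an absolutely convergent Fourier series, whose
coefficients can be read off. This links the pointwise expansions in `hardyPlus` to Laurent
coefficients, and so to square summability. -/
lemma coeff_of_hasSum {f : HardySpace} {a : ℕ × ℕ → ℂ}
    (h : ∀ p : triangle, HasSum (fun n : ℕ × ℕ => a n * p.1.1 ^ n.1 * p.1.2 ^ n.2) (f p)) :
    ∀ n, coeff f (expo n) = a n := by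
  have h2 : (2⁻¹ : ℝ) ∈ Ioo (0 : ℝ) 1 := by constructor <;> norm_num
  have hn : ((2⁻¹ : ℝ) : ℂ) ≠ 0 := by norm_num
  set r : ℂ := ((2⁻¹ : ℝ) : ℂ) with hr
  -- With `s = t = r` one has `|z| = r * r` and `|w| = r`; the coefficients at exponents outside
  -- `ℕ²` are zero.
  set c : (Fin 2 → ℤ) → ℂ := Function.extend expo (fun n => a n * (r * r) ^ n.1 * r ^ n.2) 0
    with hc
  have hc0 : ∀ α ∉ range expo, c α = 0 := fun α hα => Function.extend_apply' _ _ _ hα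
  have hcn : ∀ n, c (expo n) = a n * (r * r) ^ n.1 * r ^ n.2 := fun n =>
    expo_injective.extend_apply _ _ _
  have hsum : ∀ x : Torus, HasSum (fun α => c α * mFourier α x) (slice f 2⁻¹ 2⁻¹ x) := by
    intro x
    rw [slice_apply _ h2 h2, ← expo_injective.hasSum_iff fun α hα => by rw [hc0 α hα, zero_mul]]
    refine HasSum.congr_fun (h ⟨_, mem_triangle h2 h2 (x 0).toCircle (x 1).toCircle⟩) fun n => ?_
    have e : mFourier (expo n) x = ((x 0).toCircle : ℂ) ^ n.1 * ((x 1).toCircle : ℂ) ^ n.2 := by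
      simp [mFourier, expo, fourier_apply, AddCircle.toCircle_zsmul]
    simp only [Function.comp_apply, hcn, e, mul_pow]
    ring
  -- At the point `0` of the torus every character equals one.
  have hs : Summable c := by simpa [mFourier] using (hsum 0).summable
  have key : ∀ α, r ^ α 0 * r ^ (α 0 + α 1) * coeff f α = c α := fun α => by
    rw [← mFourierCoeff_of_hasSum hs hsum α, mFourierCoeff_slice f.coe_mem.1 α h2 h2, ← hr]
    ring
  have hne : ∀ α : Fin 2 → ℤ, r ^ α 0 * r ^ (α 0 + α 1) ≠ 0 := fun α =>
    mul_ne_zero (zpow_ne_zero _ hn) (zpow_ne_zero _ hn)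
  refine fun n => mul_left_cancel₀ (hne (expo n)) ?_
  rw [key, hcn, zpow_add₀ hn]
  simp only [expo, Matrix.cons_val_zero, Matrix.cons_val_one, zpow_natCast, mul_pow]
  ring

/-- The power series coefficients are among the Laurent coefficients, hence square summable;
conversely every square summable family gives a pointwise convergent power series. -/
theorem hardyPlus_eq_range : hardyPlus = range (seriesMul orthonormal_monomialMul_oneFun) := by
  have happ : ∀ (a : lp (fun _ : ℕ × ℕ => ℂ) 2) (p : triangle),
      HasSum (fun n : ℕ × ℕ => a n * p.1.1 ^ n.1 * p.1.2 ^ n.2)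
        (seriesMul orthonormal_monomialMul_oneFun a p) := fun a p => by
    simpa [oneFun_apply] using hasSum_seriesMul_apply orthonormal_monomialMul_oneFun a p
  ext f
  constructor
  · rintro ⟨a, ha⟩
    have h1 := coeff_of_hasSum (a := fun n => a n.1 n.2) ha
    have hs : Summable fun n : ℕ × ℕ => ‖a n.1 n.2‖ ^ 2 :=
      ((summable_coeff f.coe_mem).comp_injective expo_injective).congr fun n => by
        simp [h1]
    refine ⟨⟨fun n => a n.1 n.2, memℓp_gen (by simpa using hs)⟩, DFunLike.ext _ _ fun p => ?_⟩
    exact (happ _ p).unique (ha p)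
  · rintro ⟨a, rfl⟩
    exact ⟨fun i j => a (i, j), fun p => happ a p⟩

/-- The products of `q` with the power series in the Hardy space. -/
theorem image_mul_hardyPlus {q : HardySpace} (hq : Orthonormal ℂ fun n => monomialMul n q) :
    (fun g : HardySpace => (q : triangle → ℂ) * (g : triangle → ℂ)) '' hardyPlus =
      (fun f : HardySpace => (f : triangle → ℂ)) '' range (seriesMul hq) := by
  rw [hardyPlus_eq_range, ← range_comp, ← range_comp]
  congr 1
  ext a p
  have h1 := (hasSum_seriesMul_apply orthonormal_monomialMul_oneFun a p).mul_left (q p)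
  simp only [oneFun_apply, one_mul] at h1
  exact h1.unique (hasSum_seriesMul_apply hq a p)

/-- Ensures that `q` itself belongs to `q` times the power series. -/
lemma oneFun_mem_hardyPlus : oneFun ∈ hardyPlus := by
  refine ⟨fun i j => if (i, j) = (0, 0) then 1 else 0, fun p => ?_⟩
  refine HasSum.congr_fun (hasSum_ite_eq ((0, 0) : ℕ × ℕ) (1 : ℂ)) fun n => ?_
  by_cases h : n = (0, 0)
  · simp [h]
  · simp [h]

/-! ### Submodules -/

namespace HardySubmodule

open ContinuousLinearMap (adjoint adjoint_inner_left)

variable (S : HardySubmodule)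

lemma coe_Sz (x : S.toSubmodule) : (S.Sz x : HardySpace) = Mz x := rfl

lemma coe_Sw (x : S.toSubmodule) : (S.Sw x : HardySpace) = Mw x := rfl

lemma coe_Sz_pow (n : ℕ) (x : S.toSubmodule) : ((S.Sz ^ n) x : HardySpace) = (Mz ^ n) x := by
  induction n with
  | zero => rfl
  | succ n ih => rw [pow_succ', pow_succ', mul_apply_eq_comp, mul_apply_eq_comp, coe_Sz, ih]

lemma coe_Sw_pow (n : ℕ) (x : S.toSubmodule) : ((S.Sw ^ n) x : HardySpace) = (Mw ^ n) x := by
  induction n with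
  | zero => rfl
  | succ n ih => rw [pow_succ', pow_succ', mul_apply_eq_comp, mul_apply_eq_comp, coe_Sw, ih]

lemma coe_Sz_pow_Sw_pow (n : ℕ × ℕ) (x : S.toSubmodule) :
    ((S.Sz ^ n.1) ((S.Sw ^ n.2) x) : HardySpace) = monomialMul n x := by
  rw [coe_Sz_pow, coe_Sw_pow, monomialMul, mul_apply_eq_comp]

lemma monomialMul_mem (n : ℕ × ℕ) {x : HardySpace} (hx : x ∈ S.toSubmodule) :
    monomialMul n x ∈ S.toSubmodule := by
  have := S.coe_Sz_pow_Sw_pow n ⟨x, hx⟩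
  rw [← this]
  exact Subtype.property _

lemma adjoint_Sz_mul_Sz : adjoint S.Sz * S.Sz = 1 := by
  refine (ContinuousLinearMap.norm_map_iff_adjoint_comp_self S.Sz).1 fun x => ?_
  rw [← Submodule.norm_coe, coe_Sz, ← monomialMul_one_zero, norm_monomialMul, Submodule.norm_coe]

lemma adjoint_Sw_mul_Sw : adjoint S.Sw * S.Sw = 1 := by
  refine (ContinuousLinearMap.norm_map_iff_adjoint_comp_self S.Sw).1 fun x => ?_
  rw [← Submodule.norm_coe, coe_Sw, ← monomialMul_zero_one, norm_monomialMul, Submodule.norm_coe]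

lemma commute_Sz_Sw : Commute S.Sz S.Sw := by
  refine ContinuousLinearMap.ext fun x => Subtype.ext (DFunLike.ext _ _ fun p => ?_)
  exact mul_left_comm _ _ _

lemma isDoublyCommuting_iff : S.IsDoublyCommuting ↔ Commute (adjoint S.Sz) S.Sw := by
  rw [IsDoublyCommuting, commute_iff_lie_eq]

lemma eq_zero_of_coeff {x : HardySpace} (h : ∀ α ∈ indexSet, coeff x α = 0) : x = 0 := by
  refine coeffMap_injective (lp.ext (funext fun α => ?_))
  rw [map_zero, coeffMap_apply]
  by_cases hα : α ∈ indexSet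
  · exact h α hα
  · exact coeff_eq_zero x.coe_mem hα

/-- Multiplication by `z ^ n` shifts the first exponent by `n`. For `n > α 0` the coefficient at `α`
comes from a negative power of `z`, which does not occur. -/
lemma pure_Sz (x : S.toSubmodule) (h : ∀ n : ℕ, ∃ y, x = (S.Sz ^ n) y) : x = 0 := by
  refine Subtype.ext (eq_zero_of_coeff fun α hα => ?_)
  obtain ⟨y, hy⟩ := h ((α 0).toNat + 1)
  have e := S.coe_Sz_pow_Sw_pow ((α 0).toNat + 1, 0) y
  simp only [pow_zero, one_apply_eq_self] at e
  rw [hy, e, coeff_monomialMul]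
  refine coeff_eq_zero y.1.coe_mem fun hm => ?_
  have := hm.1
  have := hα.1
  simp [expo] at *

/-- Here `α 0 + α 1 + 1` plays the role of the exponent that is bounded below. The power of `w`
alone is not, since negative powers of `w` occur. -/
lemma pure_Sw (x : S.toSubmodule) (h : ∀ n : ℕ, ∃ y, x = (S.Sw ^ n) y) : x = 0 := by
  refine Subtype.ext (eq_zero_of_coeff fun α hα => ?_)
  obtain ⟨y, hy⟩ := h ((α 0 + α 1 + 1).toNat + 1)
  have e := S.coe_Sz_pow_Sw_pow (0, (α 0 + α 1 + 1).toNat + 1) y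
  simp only [pow_zero, one_apply_eq_self] at e
  rw [hy, e, coeff_monomialMul]
  refine coeff_eq_zero y.1.coe_mem fun hm => ?_
  have := hm.2
  have := hα.2
  simp [expo] at *
  lia

lemma inner_monomialMul_of_wandering (hd : S.IsDoublyCommuting) {x y : S.toSubmodule}
    (hxz : adjoint S.Sz x = 0) (hxw : adjoint S.Sw x = 0) (hyz : adjoint S.Sz y = 0)
    (hyw : adjoint S.Sw y = 0) (m n : ℕ × ℕ) :
    inner ℂ (monomialMul m (x : HardySpace)) (monomialMul n (y : HardySpace)) =
      if m = n then inner ℂ x y else 0 := by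
  split_ifs with h
  · rw [h, inner_monomialMul_self]; rfl
  · rw [← coe_Sz_pow_Sw_pow, ← coe_Sz_pow_Sw_pow, ← Submodule.coe_inner]
    exact inner_wandering S.adjoint_Sz_mul_Sz S.adjoint_Sw_mul_Sw (S.isDoublyCommuting_iff.1 hd)
      hxz hxw hyz hyw h

/-- A vector of a doubly commuting submodule that is orthogonal to all products of monomials with
vectors of the wandering subspace vanishes. -/
lemma eq_zero_of_inner_wandering (hd : S.IsDoublyCommuting) {x : S.toSubmodule}
    (hx : ∀ u : S.toSubmodule, adjoint S.Sz u = 0 → adjoint S.Sw u = 0 → ∀ n : ℕ × ℕ,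
      inner ℂ (monomialMul n (u : HardySpace)) (x : HardySpace) = 0) : x = 0 := by
  refine eq_zero_of_forall_inner_wandering S.adjoint_Sz_mul_Sz S.adjoint_Sw_mul_Sw S.commute_Sz_Sw
    (S.isDoublyCommuting_iff.1 hd) S.pure_Sz S.pure_Sw fun u hz hw i j => ?_
  have := hx u hz hw (i, j)
  rwa [← coe_Sz_pow_Sw_pow, ← Submodule.coe_inner] at this

/-- A nonzero doubly commuting submodule is generated by a unimodular function. -/
theorem exists_eq_range_seriesMul (hS : S.toSubmodule ≠ ⊥) (hd : S.IsDoublyCommuting) :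
    ∃ q : HardySpace, ∃ hq : Orthonormal ℂ fun n => monomialMul n q,
      (S.toSubmodule : Set HardySpace) = range (seriesMul hq) := by
  -- A zero wandering subspace would make every vector of `S` vanish by the Wold decomposition.
  obtain ⟨u, huz, huw, hu0⟩ : ∃ u : S.toSubmodule, adjoint S.Sz u = 0 ∧ adjoint S.Sw u = 0 ∧
      u ≠ 0 := by
    by_contra! h
    refine hS ((Submodule.eq_bot_iff _).2 fun x hx => ?_)
    have := S.eq_zero_of_inner_wandering hd (x := ⟨x, hx⟩) fun u hz hw n => by
      simp [h u hz hw]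
    exact congrArg Subtype.val this
  set q : S.toSubmodule := ((‖u‖⁻¹ : ℝ) : ℂ) • u with hqdef
  have hqz : adjoint S.Sz q = 0 := by rw [hqdef, map_smul, huz, smul_zero]
  have hqw : adjoint S.Sw q = 0 := by rw [hqdef, map_smul, huw, smul_zero]
  have hqn : ‖q‖ = 1 := by
    rw [hqdef, norm_smul, Complex.norm_real, norm_inv, norm_norm,
      inv_mul_cancel₀ (norm_ne_zero_iff.2 hu0)]
  have hqq : inner ℂ q q = 1 := inner_self_eq_one_of_norm_eq_one hqn
  have hq : Orthonormal ℂ fun n => monomialMul n (q : HardySpace) := by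
    rw [orthonormal_iff_ite]
    intro m n
    rw [S.inner_monomialMul_of_wandering hd hqz hqw hqz hqw, hqq]
  -- The wandering subspace is a line: `g - ⟨q, g⟩ q` is wandering and orthogonal to `q`, so all its
  -- monomial multiples are orthogonal to those of the unimodular `q`.
  have hspan : ∀ g : S.toSubmodule, adjoint S.Sz g = 0 → adjoint S.Sw g = 0 →
      g = inner ℂ q g • q := by
    intro g hgz hgw
    rw [← sub_eq_zero]
    refine Subtype.ext (eq_zero_of_inner_unimodular ((isUnimodular_iff_orthonormal _).2 hq)
      fun m n => ?_)
    rw [S.inner_monomialMul_of_wandering hd hqz hqw (by simp [hgz, hqz]) (by simp [hgw, hqw]),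
      inner_sub_right, show inner ℂ q (inner ℂ q g • q) = inner ℂ q g * inner ℂ q q from
        inner_smul_right (𝕜 := ℂ) (E := S.toSubmodule) q q (inner ℂ q g), hqq]
    simp
  have hmem : ∀ a, seriesMul hq a ∈ S.toSubmodule := fun a =>
    S.isClosed'.mem_of_tendsto (hasSum_seriesMul hq a) (Eventually.of_forall fun s =>
      Submodule.sum_mem _ fun n _ => Submodule.smul_mem _ _ (S.monomialMul_mem n q.2))
  refine ⟨q, hq, Subset.antisymm (fun x hx => ?_) ?_⟩
  · have hsub : Orthonormal ℂ fun n =>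
        (⟨monomialMul n q, S.monomialMul_mem n q.2⟩ : S.toSubmodule) := by
      rw [orthonormal_iff_ite] at hq ⊢
      exact hq
    -- By `hspan` every wandering vector is a multiple of `q`, so orthogonality to the monomial
    -- multiples of `q` is all that the Wold decomposition asks for.
    let b : HilbertBasis (ℕ × ℕ) ℂ S.toSubmodule := HilbertBasis.mkOfOrthogonalEqBot hsub (by
      rw [Submodule.eq_bot_iff]
      intro y hy
      refine S.eq_zero_of_inner_wandering hd fun v hz hw n => ?_
      have := (Submodule.mem_orthogonal _ _).1 hy _ (Submodule.subset_span ⟨n, rfl⟩)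
      rw [Submodule.coe_inner] at this
      rw [hspan v hz hw, Submodule.coe_smul, map_smul, inner_smul_left, this, mul_zero])
    have h1 := S.toSubmodule.subtypeL.hasSum (b.hasSum_repr ⟨x, hx⟩)
    refine ⟨b.repr ⟨x, hx⟩, (hasSum_seriesMul hq _).unique ?_⟩
    refine HasSum.congr_fun h1 fun n => ?_
    simp [b]
  · rintro _ ⟨a, rfl⟩
    exact hmem a

/-- The products of the power series with a unimodular function form a doubly commuting
submodule. -/
theorem isDoublyCommuting_of_eq_range {q : HardySpace}
    (hq : Orthonormal ℂ fun n => monomialMul n q)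
    (hS : (S.toSubmodule : Set HardySpace) = range (seriesMul hq)) : S.IsDoublyCommuting := by
  have hmem : ∀ n, monomialMul n q ∈ S.toSubmodule := fun n => by
    rw [← SetLike.mem_coe, hS]
    refine ⟨lp.single 2 n (1 : ℂ), ?_⟩
    rw [seriesMul, hq.orthogonalFamily.linearIsometry_apply_single]
    simp
  set e : ℕ × ℕ → S.toSubmodule := fun n => ⟨monomialMul n q, hmem n⟩ with he
  -- Every vector of `S` is a convergent sum of multiples of the `e n`, so bounded operators can be
  -- compared on the `e n`.
  have hext : ∀ A B : S.toSubmodule →L[ℂ] S.toSubmodule, (∀ n, A (e n) = B (e n)) → A = B := by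
    intro A B h
    ext1 x
    obtain ⟨a, ha⟩ : (x : HardySpace) ∈ range (seriesMul hq) := hS ▸ x.2
    have hsum : HasSum (fun n => a n • e n) x := by
      rw [← Topology.IsInducing.subtypeVal.hasSum_iff (g := S.toSubmodule.subtype),
        Submodule.subtype_apply, ← ha]
      exact hasSum_seriesMul hq a
    refine (A.hasSum hsum).unique (HasSum.congr_fun (B.hasSum hsum) fun n => ?_)
    rw [map_smul, map_smul, h]
  have hez : ∀ n : ℕ × ℕ, S.Sz (e n) = e (n.1 + 1, n.2) := fun n => by
    refine Subtype.ext ?_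
    rw [coe_Sz]
    simp only [he, monomialMul, pow_succ', mul_apply_eq_comp]
  have hew : ∀ n : ℕ × ℕ, S.Sw (e n) = e (n.1, n.2 + 1) := fun n => by
    refine Subtype.ext (DFunLike.ext _ _ fun p => ?_)
    rw [coe_Sw, Mw_apply]
    simp only [he, monomialMul_apply]
    ring
  have hadj : ∀ n : ℕ × ℕ, adjoint S.Sz (e (n.1 + 1, n.2)) = e n := fun n => by
    rw [← hez, ← mul_apply_eq_comp, S.adjoint_Sz_mul_Sz, one_apply_eq_self]
  have hinner : ∀ m n, inner ℂ (e m) (e n) = if m = n then (1 : ℂ) else 0 :=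
    fun m n => orthonormal_iff_ite.1 hq m n
  have hadj0 : ∀ j : ℕ, adjoint S.Sz (e (0, j)) = 0 := fun j => by
    -- `S_z` raises the first index, so its range is orthogonal to `e (0, j)`. Attaching the unit
    -- vector `e 0` turns the functional `⟨e (0, j), S_z y⟩` into an operator on `S`, to which
    -- `hext` applies.
    have h0 : (innerSL ℂ (e (0, j))).smulRight (e 0) ∘L S.Sz = 0 := hext _ _ fun n => by
      simp [hez, hinner]
    refine ext_inner_right ℂ fun y => ?_
    have h1 := congrArg (inner ℂ (e 0)) (DFunLike.congr_fun h0 y)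
    rw [adjoint_inner_left, inner_zero_left]
    simpa [hinner] using h1
  rw [isDoublyCommuting_iff]
  refine hext _ _ fun n => ?_
  obtain ⟨i, j⟩ := n
  rw [mul_apply_eq_comp, mul_apply_eq_comp, hew]
  cases i with
  | zero => rw [hadj0, hadj0, map_zero]
  | succ i => rw [hadj (i, j + 1), hadj (i, j), hew]

end HardySubmodule

end Hartogs

end

/-! ### The characterization of doubly commuting submodules -/

theorem theorem1p1 (S : Hartogs.HardySubmodule) (hS : S.toSubmodule ≠ ⊥) :
    S.IsDoublyCommuting ↔
      ∃ q : Hartogs.triangle → ℂ, Hartogs.IsUnimodular q ∧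
        (fun f : Hartogs.HardySpace => (f : Hartogs.triangle → ℂ)) '' (S.toSubmodule : Set Hartogs.HardySpace) =
          (fun g : Hartogs.HardySpace => q * (g : Hartogs.triangle → ℂ)) '' Hartogs.hardyPlus := by
  constructor
  · intro hd
    obtain ⟨q, hq, h⟩ := S.exists_eq_range_seriesMul hS hd
    exact ⟨q, (Hartogs.isUnimodular_iff_orthonormal q).2 hq, by
      rw [Hartogs.image_mul_hardyPlus hq, h]⟩
  · rintro ⟨q, hu, h⟩
    -- `q` is given only as a function on the triangle. As the constant one is a power series, `q =
    -- q * 1` lies in `S`, and in particular in the Hardy space.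
    obtain ⟨f, -, hf⟩ : q ∈ (fun f : Hartogs.HardySpace => (f : Hartogs.triangle → ℂ)) ''
        (S.toSubmodule : Set Hartogs.HardySpace) := by
      rw [h]
      exact ⟨Hartogs.oneFun, Hartogs.oneFun_mem_hardyPlus, mul_one q⟩
    subst hf
    have hq := (Hartogs.isUnimodular_iff_orthonormal f).1 hu
    refine S.isDoublyCommuting_of_eq_range hq ?_
    rw [Hartogs.image_mul_hardyPlus hq] at h
    exact DFunLike.coe_injective.image_injective h
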